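/- Let $N\in\mathbb N$, let $J$ be a real $2N\times 2N$ matrix with $J^T=J^{-1}=-J$, and let $H:\mathbb R\times\mathbb R^{2N}\times\mathbb R\to\mathbb R$, $(t,\xi,\lambda)\mapsto H(t,\xi,\lambda)$. Write $L^2=L^2(\mathbb R,\mathbb R^{2N})$ and $H^1=H^1(\mathbb R,\mathbb R^{2N})$. A function $f(t,\xi)$ is called an equicontinuous $C^0_\xi$-bundle map if it is continuous and the family $\{f(t,\cdot)\}_{t\in\mathbb R}$ is equicontinuous at every point $\xi$; it is an equicontinuous $C^1_\xi$-bundle map if $f$ and $D_\xi f$ exist and are equicontinuous $C^0_\xi$-bundle maps. Assume: (H1) $H$ is continuous, $H(t,\cdot,\lambda)\in C^2(\mathbb R^{2N})$ and $D_\xi H(t,0,\lambda)=0$ for all $t,\lambda\in\mathbb R$. (H2) The partial derivatives $D_\xi H$, $D_\xi^2H$, $D_\lambda D_\xi H$, $D_\lambda D_\xi^2H$ and $D_\xi D_\lambda D_\xi H$ exist and are continuous on $\mathbb R\times\mathbb R^{2N}\times\mathbb R$. (H3) For each $\lambda$, $D_\xi H(\cdot,\cdot,\lambda)$ is an equicontinuous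 $C^1_\xi$-bundle map, and $D_\lambda D_\xi^2H$ is an equicontinuous $C^0_{(\xi,\lambda)}$-bundle map. (H4) $D_\xi^2H(\cdot,0,0)$ and $D_\lambda D_\xi^2H(\cdot,0,0)$ belong to $L^\infty(\mathbb R)$. (H$^\infty$) For every $\lambda\in\mathbb R$ there are equicontinuous $C^1_\xi$-bundle maps $g^\pm(\cdot,\cdot,\lambda):\mathbb R\times\mathbb R^{2N}\to\mathbb R^{2N}$ and periods $T^\pm=T^\pm(\lambda)>0$ such that $g^\pm(t,0,\lambda)=0$ for all $t$; $g^\pm(t+T^\pm,\xi,\lambda)=g^\pm(t,\xi,\lambda)$ for all $(t,\xi)$; and $D_\xi^2H(t,\xi,\lambda)-D_\xi g^\pm(t,\xi,\lambda)\to0$ as $t\to\pm\infty$, uniformly for $\xi$ in bounded subsets of $\mathbb R^{2N}$. Fix $\lambda\in\mathbb R$, set $A_\lambda(t)=D_\xi^2H(t,0,\lambda)$ and $A^\pm_\lambda(t)=D_\xi g^\pm(t,0,\lambda)$, and assume that neither of the $T^\pm$-periodic linear systems $Jx'-A^+_\lambda(t)x=0$ and $Jx'-A^-_\lambda(t)x=0$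 has a characteristic multiplier on the unit circle; here the characteristic multipliers of $Jx'-A(t)x=0$ with period $T$ are the complex eigenvalues of $X(T)$, where $JX'=A(t)X$, $X(0)=I$. Then $F(\lambda,x)=Jx'-D_\xi H(\cdot,x(\cdot),\lambda)$ defines a map $F(\lambda,\cdot):H^1\to L^2$ which is Fréchet differentiable at $0$, and $D_xF(\lambda,0):H^1\to L^2$ is a bounded Fredholm operator of index zero (its range is closed, and $\dim\ker D_xF(\lambda,0)=\operatorname{codim}\operatorname{rge}D_xF(\lambda,0)<\infty$). Furthermore (identifying functions that are equal almost everywhere) $\ker D_xF(\lambda,0)=N(\lambda)$, where $$N(\lambda)=\{u\in C^1(\mathbb R,\mathbb R^{2N}): Ju'(t)-A_\lambda(t)u(t)\equiv0\ \text{and}\ \lim_{|t|\to\infty}u(t)=0\},$$ and every $u\in N(\lambda)$ decays exponentially: there are $C\in\mathbb R$ and $\gamma>0$ with $\|u(t)\|\le Ce^{-\gamma|t|}$ for all $t\in\mathbb R$. -/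

import Mathlib

open MeasureTheory Filter Topology
open scoped ContDiff ENNReal

namespace HamHom

/-- The phase space `ℝ^{2N}` with its Euclidean norm. -/
abbrev Phase (N : ℕ) : Type := EuclideanSpace ℝ (Fin (2 * N))

/-- `L² = L²(ℝ, ℝ^{2N})`. -/
abbrev L2 (N : ℕ) : Type := Lp (Phase N) 2 (volume : Measure ℝ)

/-- `v` is the weak derivative of `u`, for classes `u, v ∈ L²(ℝ, ℝ^{2N})`. -/
def IsWeakDeriv {N : ℕ} (u v : L2 N) : Prop :=
  ∀ φ : ℝ → ℝ, ContDiff ℝ ∞ φ → HasCompactSupport φ →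
    ∫ t, deriv φ t • u t = -∫ t, φ t • v t

/-- A continuous compactly supported scalar function times an `L²` function is integrable. -/
theorem integrable_test_smul {N : ℕ} {φ : ℝ → ℝ} (hφ : Continuous φ) (hc : HasCompactSupport φ)
    (u : L2 N) : Integrable (fun t => φ t • u t) volume := by
  have h : MemLp (φ • (u : ℝ → Phase N)) 1 volume :=
    (Lp.memLp u).smul (p := 2) (q := 2) (r := 1) (hφ.memLp_of_hasCompactSupport hc)
  exact memLp_one_iff_integrable.mp h

/-- The Sobolev space `H¹(ℝ, ℝ^{2N})`, as the graph of the weak derivative in `L² × L²`; an element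
is a pair `(x, x')`. The norm inherited from the `ℓ²`-product is `(‖x‖₂² + ‖x'‖₂²)^{1/2}`. -/
noncomputable def H1 (N : ℕ) : Submodule ℝ (WithLp 2 (L2 N × L2 N)) where
  carrier := {p | IsWeakDeriv p.fst p.snd}
  zero_mem' := by
    intro φ _ _
    have h0 : ((0 : L2 N) : ℝ → Phase N) =ᵐ[volume] 0 := Lp.coeFn_zero _ _ _
    have h1 : ∫ t, deriv φ t • (0 : L2 N) t = 0 := by
      rw [integral_congr_ae (g := fun _ => (0 : Phase N)) (by
        filter_upwards [h0] with t ht; rw [ht]; simp)]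
      simp
    have h2 : ∫ t, φ t • (0 : L2 N) t = 0 := by
      rw [integral_congr_ae (g := fun _ => (0 : Phase N)) (by
        filter_upwards [h0] with t ht; rw [ht]; simp)]
      simp
    simp only [WithLp.zero_fst, WithLp.zero_snd]
    rw [h1, h2, neg_zero]
  add_mem' := by
    intro p q hp hq φ hφ hc
    have hd : Continuous (deriv φ) := hφ.continuous_deriv (by simp)
    have e1 : ∫ t, deriv φ t • (p.fst + q.fst) t
        = ∫ t, (deriv φ t • p.fst t + deriv φ t • q.fst t) := by
      refine integral_congr_ae ?_
      filter_upwards [Lp.coeFn_add p.fst q.fst] with t ht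
      rw [ht, Pi.add_apply, smul_add]
    have e2 : ∫ t, φ t • (p.snd + q.snd) t
        = ∫ t, (φ t • p.snd t + φ t • q.snd t) := by
      refine integral_congr_ae ?_
      filter_upwards [Lp.coeFn_add p.snd q.snd] with t ht
      rw [ht, Pi.add_apply, smul_add]
    simp only [WithLp.add_fst, WithLp.add_snd]
    rw [e1, e2, integral_add (integrable_test_smul hd hc.deriv _)
      (integrable_test_smul hd hc.deriv _),
      integral_add (integrable_test_smul hφ.continuous hc _)
      (integrable_test_smul hφ.continuous hc _), hp φ hφ hc, hq φ hφ hc, neg_add]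
  smul_mem' := by
    intro c p hp φ hφ hc
    have e1 : ∫ t, deriv φ t • (c • p.fst) t = ∫ t, c • (deriv φ t • p.fst t) := by
      refine integral_congr_ae ?_
      filter_upwards [Lp.coeFn_smul c p.fst] with t ht
      rw [ht, Pi.smul_apply, smul_comm]
    have e2 : ∫ t, φ t • (c • p.snd) t = ∫ t, c • (φ t • p.snd t) := by
      refine integral_congr_ae ?_
      filter_upwards [Lp.coeFn_smul c p.snd] with t ht
      rw [ht, Pi.smul_apply, smul_comm]
    simp only [WithLp.smul_fst, WithLp.smul_snd]
    rw [e1, e2, integral_smul, integral_smul, hp φ hφ hc, smul_neg]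

/-- The function underlying an element of `H¹`, as an element of `L²`. -/
noncomputable def sobFn {N : ℕ} (x : H1 N) : L2 N := (x : WithLp 2 (L2 N × L2 N)).fst

/-- The weak derivative of an element of `H¹`. -/
noncomputable def sobDeriv {N : ℕ} (x : H1 N) : L2 N := (x : WithLp 2 (L2 N × L2 N)).snd

/-- A real `2N × 2N` matrix acting on `ℝ^{2N}`. -/
noncomputable abbrev act {N : ℕ} (J : Matrix (Fin (2 * N)) (Fin (2 * N)) ℝ) :
    Phase N →L[ℝ] Phase N :=
  Matrix.toEuclideanCLM (n := Fin (2 * N)) (𝕜 := ℝ) J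

/-- `J^T = J^{-1} = -J`. -/
def IsSymplecticUnit {N : ℕ} (J : Matrix (Fin (2 * N)) (Fin (2 * N)) ℝ) : Prop :=
  J.transpose * J = 1 ∧ J.transpose = -J

section Hamiltonian

variable {N : ℕ} (H : ℝ → Phase N → ℝ → ℝ)

/-- `D_ξ H (t, ξ, λ) = ∇H (t, ξ, λ)`. -/
noncomputable def gradH (t : ℝ) (ξ : Phase N) (lam : ℝ) : Phase N :=
  gradient (fun η => H t η lam) ξ

/-- `D_ξ² H (t, ξ, λ)`, as a linear operator on `ℝ^{2N}`. -/
noncomputable def hessH (t : ℝ) (ξ : Phase N) (lam : ℝ) : Phase N →L[ℝ] Phase N :=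
  fderiv ℝ (fun η => gradH H t η lam) ξ

/-- `D_λ D_ξ H`. -/
noncomputable def dlamGradH (t : ℝ) (ξ : Phase N) (lam : ℝ) : Phase N :=
  deriv (fun μ => gradH H t ξ μ) lam

/-- `D_λ D_ξ² H`. -/
noncomputable def dlamHessH (t : ℝ) (ξ : Phase N) (lam : ℝ) : Phase N →L[ℝ] Phase N :=
  deriv (fun μ => hessH H t ξ μ) lam

/-- `D_ξ D_λ D_ξ H`. -/
noncomputable def dxiDlamGradH (t : ℝ) (ξ : Phase N) (lam : ℝ) : Phase N →L[ℝ] Phase N :=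
  fderiv ℝ (fun η => dlamGradH H t η lam) ξ

end Hamiltonian

/-- Joint continuity of a function of `(t, ξ, λ)`. -/
def JointlyContinuous {N : ℕ} {Y : Type*} [TopologicalSpace Y] (f : ℝ → Phase N → ℝ → Y) : Prop :=
  Continuous fun p : ℝ × Phase N × ℝ => f p.1 p.2.1 p.2.2

/-- Equicontinuous `C⁰`-bundle maps `f(t, ξ)`: `f` is jointly continuous and the family
`{f(t, ·)}_t` is equicontinuous at every point. -/
def IsC0BundleMap {X Y : Type*} [TopologicalSpace X] [UniformSpace Y] (f : ℝ → X → Y) : Prop :=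
  Continuous (fun p : ℝ × X => f p.1 p.2) ∧ Equicontinuous f

/-- Equicontinuous `C¹_ξ`-bundle maps `f(t, ξ)`: `f` and its first derivative in `ξ` are
equicontinuous `C⁰`-bundle maps. -/
def IsC1BundleMap {X Y : Type*} [NormedAddCommGroup X] [NormedSpace ℝ X] [NormedAddCommGroup Y]
    [NormedSpace ℝ Y] (f : ℝ → X → Y) : Prop :=
  (∀ t, Differentiable ℝ (f t)) ∧ IsC0BundleMap f ∧ IsC0BundleMap fun t ξ => fderiv ℝ (f t) ξ

/-- `H` is continuous, `C²` in `ξ`, and `D_ξ H(t, 0, λ) = 0`. -/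
structure HypH1 {N : ℕ} (H : ℝ → Phase N → ℝ → ℝ) : Prop where
  cont : JointlyContinuous H
  contDiff : ∀ t lam, ContDiff ℝ 2 fun ξ => H t ξ lam
  grad_zero : ∀ t lam, gradH H t 0 lam = 0

/-- `D_ξ H`, `D_ξ² H`, `D_λ D_ξ H`, `D_λ D_ξ² H`, `D_ξ D_λ D_ξ H` exist and are continuous. -/
structure HypH2 {N : ℕ} (H : ℝ → Phase N → ℝ → ℝ) : Prop where
  diff_grad : ∀ t lam, Differentiable ℝ fun ξ => H t ξ lam
  diff_hess : ∀ t lam, Differentiable ℝ fun ξ => gradH H t ξ lam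
  diff_dlamGrad : ∀ t ξ, Differentiable ℝ fun lam => gradH H t ξ lam
  diff_dlamHess : ∀ t ξ, Differentiable ℝ fun lam => hessH H t ξ lam
  diff_dxiDlamGrad : ∀ t lam, Differentiable ℝ fun ξ => dlamGradH H t ξ lam
  cont_grad : JointlyContinuous (gradH H)
  cont_hess : JointlyContinuous (hessH H)
  cont_dlamGrad : JointlyContinuous (dlamGradH H)
  cont_dlamHess : JointlyContinuous (dlamHessH H)
  cont_dxiDlamGrad : JointlyContinuous (dxiDlamGradH H)

/-- `D_ξ H(·, ·, λ)` is an equicontinuous `C¹_ξ`-bundle map for each `λ`, and `D_λ D_ξ² H` is an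
equicontinuous `C⁰_{(ξ, λ)}`-bundle map. -/
structure HypH3 {N : ℕ} (H : ℝ → Phase N → ℝ → ℝ) : Prop where
  grad_bundle : ∀ lam, IsC1BundleMap fun t ξ => gradH H t ξ lam
  dlamHess_bundle : IsC0BundleMap fun t (p : Phase N × ℝ) => dlamHessH H t p.1 p.2

/-- `D_ξ² H(·, 0, 0)` and `D_λ D_ξ² H(·, 0, 0)` are in `L^∞(ℝ)`. -/
structure HypH4 {N : ℕ} (H : ℝ → Phase N → ℝ → ℝ) : Prop where
  hess_bdd : MemLp (fun t => hessH H t 0 0) ∞ (volume : Measure ℝ)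
  dlamHess_bdd : MemLp (fun t => dlamHessH H t 0 0) ∞ (volume : Measure ℝ)

/-- Asymptotic periodicity: `g⁺(·, ·, λ)` and `g⁻(·, ·, λ)` are bundle maps, periodic in `t` with periods
`T⁺(λ), T⁻(λ) > 0`, vanishing at
`ξ = 0`, and `D_ξ² H - D_ξ g^± → 0` as `t → ±∞`, uniformly for `ξ` in bounded sets. -/
structure HypHInf {N : ℕ} (H : ℝ → Phase N → ℝ → ℝ) (gp gm : ℝ → Phase N → ℝ → Phase N)
    (Tp Tm : ℝ → ℝ) : Prop where
  bundle_p : ∀ lam, IsC1BundleMap fun t ξ => gp t ξ lam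
  bundle_m : ∀ lam, IsC1BundleMap fun t ξ => gm t ξ lam
  zero_p : ∀ t lam, gp t 0 lam = 0
  zero_m : ∀ t lam, gm t 0 lam = 0
  lim_p : ∀ lam (B : Set (Phase N)), Bornology.IsBounded B →
    TendstoUniformlyOn (fun t ξ => hessH H t ξ lam - fderiv ℝ (fun η => gp t η lam) ξ)
      (fun _ => 0) atTop B
  lim_m : ∀ lam (B : Set (Phase N)), Bornology.IsBounded B →
    TendstoUniformlyOn (fun t ξ => hessH H t ξ lam - fderiv ℝ (fun η => gm t η lam) ξ)
      (fun _ => 0) atBot B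
  period_pos_p : ∀ lam, 0 < Tp lam
  period_pos_m : ∀ lam, 0 < Tm lam
  periodic_p : ∀ lam t ξ, gp (t + Tp lam) ξ lam - gp t ξ lam = 0
  periodic_m : ∀ lam t ξ, gm (t + Tm lam) ξ lam - gm t ξ lam = 0

/-- `X` is the principal fundamental solution of `J x' - A(t) x = 0`, i.e. the operator solution
with `X(0) = I`. -/
def IsPrincipalSolution {N : ℕ} (J : Matrix (Fin (2 * N)) (Fin (2 * N)) ℝ)
    (A X : ℝ → Phase N →L[ℝ] Phase N) : Prop :=
  X 0 = ContinuousLinearMap.id ℝ (Phase N) ∧ Differentiable ℝ X ∧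
    ∀ t, (act J).comp (deriv X t) - (A t).comp (X t) = 0

/-- `ρ ∈ ℂ` is a characteristic (Floquet) multiplier of the `T`-periodic system
`J x' - A(t) x = 0`: an eigenvalue of its monodromy operator `X(T)`, i.e. a complex root of the
characteristic polynomial of `X(T)`. -/
def IsCharMultiplier {N : ℕ} (J : Matrix (Fin (2 * N)) (Fin (2 * N)) ℝ)
    (A : ℝ → Phase N →L[ℝ] Phase N) (T : ℝ) (ρ : ℂ) : Prop :=
  ∃ X : ℝ → Phase N →L[ℝ] Phase N, IsPrincipalSolution J A X ∧
    Polynomial.aeval ρ (LinearMap.charpoly (X T : Phase N →ₗ[ℝ] Phase N)) = 0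

open Classical in
/-- The Nemytskii operator `h(λ, x)(t) = D_ξ H(t, x(t), λ)` on `H¹` with values in `L²`. (The value
`0` is used only if the function on the right is not square integrable.) -/
noncomputable def nemytskii {N : ℕ} (H : ℝ → Phase N → ℝ → ℝ) (lam : ℝ) (x : H1 N) : L2 N :=
  if hx : MemLp (fun t => gradH H t (sobFn x t) lam) 2 (volume : Measure ℝ) then hx.toLp else 0

/-- `F(λ, x) = J x' - h(λ, x)`, as a map `ℝ × H¹ → L²`. -/
noncomputable def F {N : ℕ} (J : Matrix (Fin (2 * N)) (Fin (2 * N)) ℝ)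
    (H : ℝ → Phase N → ℝ → ℝ) (lam : ℝ) (x : H1 N) : L2 N :=
  (act J).compLp (sobDeriv x) - nemytskii H lam x

/-- The partial derivative `D_x F(λ, x)`. -/
noncomputable def DxF {N : ℕ} (J : Matrix (Fin (2 * N)) (Fin (2 * N)) ℝ)
    (H : ℝ → Phase N → ℝ → ℝ) (lam : ℝ) (x : H1 N) : H1 N →L[ℝ] L2 N :=
  fderiv ℝ (F J H lam) x

/-- Bounded Fredholm operators of index zero: `dim ker L = codim rge L`, both finite. -/
def IsFredholmIndexZero {X Y : Type*} [NormedAddCommGroup X] [NormedSpace ℝ X]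
    [NormedAddCommGroup Y] [NormedSpace ℝ Y] (L : X →L[ℝ] Y) : Prop :=
  L.IsFredholm ∧ Module.finrank ℝ L.ker = Module.finrank ℝ (Y ⧸ L.range)

/-- `N(λ)`: the `C¹` solutions of `J u' - D_ξ²H(t, 0, λ) u = 0` that vanish at `±∞`. -/
def solN {N : ℕ} (J : Matrix (Fin (2 * N)) (Fin (2 * N)) ℝ)
    (H : ℝ → Phase N → ℝ → ℝ) (lam : ℝ) : Set (ℝ → Phase N) :=
  {u | ContDiff ℝ 1 u ∧ (∀ t, act J (deriv u t) - hessH H t 0 lam (u t) = 0) ∧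
    Tendsto u atBot (𝓝 0) ∧ Tendsto u atTop (𝓝 0)}

end HamHom

/-! Since J² = -1 and J is an isometry, the equation J x' - A x = f is the same as x' - B x = -J f
with B = -J A. All estimates are made for x' - B x.

The core is the a priori bound `HasL2Bound`: ‖u‖² ≤ C ‖u' - B u‖² in L²(ℝ). For T-periodic B it is
proved by sampling. The sequence a(n) = u(nT) obeys a(n + 1) = X(T) a(n) up to a defect, which
Grönwall's inequality controls by u' - B u on one period. Square summable sequences are controlled
by this defect when X(T) has no eigenvalue on the unit circle (`exists_tsum_sq_le`). There the
characteristic polynomial is split over ℂ, one linear factor is removed at a time, and the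
Cayley–Hamilton theorem ends the process (`exists_hasL2Bound_of_periodic`). No exponential dichotomy
or Floquet normal form is needed.

If B only approaches periodic coefficients at ±∞, the bound survives for functions vanishing at two
suitable points. Outside these points the small difference of coefficients is absorbed, and between
them Grönwall's inequality starts from a zero (`exists_bound_of_vanishing`). Vanishing at two points
is a closed condition of finite codimension, so the operator has closed range and finite-dimensional
kernel. The index is zero because J is skew and A symmetric: x ↦ J x' - A x is formally
self-adjoint, and a vector orthogonal to the range is a weak, hence classical, solution of the same
equation (`exists_ker_equiv`, `isFredholmIndexZero_of_bound`).

Decay comes from the same bound applied to a solution multiplied by a cutoff. The mass inside an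
interval is at most a constant times the mass near its ends, so for a solution tending to zero the
tail mass shrinks geometrically (`exists_exp_decay_atTop`). Decay also puts every such solution in
H¹, which identifies the kernel.

Differentiability of F at 0 rests on equicontinuity of D_ξ²H at ξ = 0, uniform in t, and on the
embedding H¹ ⊂ L^∞ (`hasFDerivAt_F`). -/

namespace HamHom

/-! ### Locally absolutely continuous functions: Grönwall and Sobolev inequalities on intervals -/

section Primitive

variable {E : Type*} [NormedAddCommGroup E] [NormedSpace ℝ E]

/-- `u` is a locally absolutely continuous function with derivative `v`: an indefinite integral of the
locally integrable function `v`. -/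
structure IsPrimitive (u v : ℝ → E) : Prop where
  locallyIntegrable : LocallyIntegrable v volume
  sub_eq : ∀ a b, u b - u a = ∫ t in a..b, v t

namespace IsPrimitive

variable {u v : ℝ → E}

theorem intervalIntegrable (h : IsPrimitive u v) (a b : ℝ) : IntervalIntegrable v volume a b :=
  (h.locallyIntegrable.integrableOn_isCompact isCompact_uIcc).intervalIntegrable

theorem eq_add (h : IsPrimitive u v) (a b : ℝ) : u b = u a + ∫ t in a..b, v t := by
  rw [← h.sub_eq a b]; abel

theorem of_base (hv : LocallyIntegrable v volume) (c : ℝ) (h : ∀ b, u b = u c + ∫ t in c..b, v t) :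
    IsPrimitive u v := by
  refine ⟨hv, fun a b => ?_⟩
  rw [h a, h b, add_sub_add_left_eq_sub]
  exact intervalIntegral.integral_interval_sub_left
    (hv.integrableOn_isCompact isCompact_uIcc).intervalIntegrable
    (hv.integrableOn_isCompact isCompact_uIcc).intervalIntegrable

theorem continuous (h : IsPrimitive u v) : Continuous u := by
  have : u = fun b => u 0 + ∫ t in (0:ℝ)..b, v t := funext fun b => h.eq_add 0 b
  rw [this]
  exact continuous_const.add (intervalIntegral.continuous_primitive h.intervalIntegrable 0)

theorem congr_ae {w : ℝ → E} (h : IsPrimitive u v) (hw : v =ᵐ[volume] w) : IsPrimitive u w := by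
  refine ⟨(locallyIntegrable_congr hw).1 h.locallyIntegrable, fun a b => ?_⟩
  rw [h.sub_eq a b]
  exact intervalIntegral.integral_congr_ae (hw.mono fun t ht _ => ht)

theorem of_hasDerivAt [CompleteSpace E] (h : ∀ t, HasDerivAt u (v t) t) (hv : Continuous v) :
    IsPrimitive u v :=
  ⟨hv.locallyIntegrable, fun a b =>
    (intervalIntegral.integral_eq_sub_of_hasDerivAt (fun t _ => h t)
      (hv.intervalIntegrable a b)).symm⟩

theorem hasDerivAt [CompleteSpace E] (h : IsPrimitive u v) (hv : Continuous v) (t : ℝ) :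
    HasDerivAt u (v t) t := by
  have : u = fun b => u 0 + ∫ t in (0:ℝ)..b, v t := funext fun b => h.eq_add 0 b
  rw [this]
  exact (intervalIntegral.integral_hasDerivAt_right (hv.intervalIntegrable _ _)
    hv.stronglyMeasurable.stronglyMeasurableAtFilter hv.continuousAt).const_add _

theorem comp_add (h : IsPrimitive u v) (c : ℝ) :
    IsPrimitive (fun t => u (t + c)) (fun t => v (t + c)) := by
  refine ⟨?_, fun a b => ?_⟩
  · exact (locallyIntegrable_iff.2 fun K hK => by
      have := h.locallyIntegrable.integrableOn_isCompact
        (hK.image (Homeomorph.addRight c).continuous)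
      have hm : MeasurePreserving (Homeomorph.addRight c) volume volume :=
        measurePreserving_add_right volume c
      exact (hm.integrableOn_image (Homeomorph.addRight c).measurableEmbedding).1 this)
  · rw [h.sub_eq, intervalIntegral.integral_comp_add_right (fun t => v t) c]

theorem comp_neg (h : IsPrimitive u v) : IsPrimitive (fun t => u (-t)) (fun t => -v (-t)) := by
  refine ⟨?_, fun a b => ?_⟩
  · exact (locallyIntegrable_iff.2 fun K hK => by
      have := h.locallyIntegrable.integrableOn_isCompact
        (hK.image (Homeomorph.neg ℝ).continuous)
      have hm : MeasurePreserving (Homeomorph.neg ℝ) volume volume :=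
        Measure.measurePreserving_neg volume
      exact ((hm.integrableOn_image (Homeomorph.neg ℝ).measurableEmbedding).1 this).neg)
  · rw [h.sub_eq, intervalIntegral.integral_neg, intervalIntegral.integral_comp_neg (fun t => v t),
      intervalIntegral.integral_symm]

/-- Truncating at a zero creates no jump, hence no extra derivative term. This is what lets a
whole-line bound be used on a half-line. -/
theorem indicator_Ioi (h : IsPrimitive u v) {R : ℝ} (hR : u R = 0) :
    IsPrimitive ((Set.Ioi R).indicator u) ((Set.Ioi R).indicator v) := by
  refine of_base ?_ R fun b => ?_
  · exact locallyIntegrable_iff.2 fun K hK =>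
      (h.locallyIntegrable.integrableOn_isCompact hK).indicator measurableSet_Ioi
  · have h0 : (Set.Ioi R).indicator u R = 0 := by simp
    rw [h0, zero_add]
    rcases le_or_gt b R with hb | hb
    · rw [Set.indicator_of_notMem (by simpa using hb)]
      rw [intervalIntegral.integral_zero_ae]
      refine Eventually.of_forall fun t ht => ?_
      rw [Set.uIoc_of_ge hb] at ht
      exact Set.indicator_of_notMem (by simpa using ht.2) _
    · rw [Set.indicator_of_mem (by simpa using hb), h.eq_add R b, hR, zero_add]
      refine intervalIntegral.integral_congr_ae (Eventually.of_forall fun t ht => ?_)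
      rw [Set.uIoc_of_le hb.le] at ht
      exact (Set.indicator_of_mem (show t ∈ Set.Ioi R from ht.1) v).symm

theorem clm_comp [CompleteSpace E] {F : Type*} [NormedAddCommGroup F] [NormedSpace ℝ F]
    [CompleteSpace F]
    (h : IsPrimitive u v) (L : E →L[ℝ] F) : IsPrimitive (fun t => L (u t)) (fun t => L (v t)) := by
  refine ⟨locallyIntegrable_iff.2 fun K hK =>
    L.integrable_comp (h.locallyIntegrable.integrableOn_isCompact hK), fun a b => ?_⟩
  rw [← map_sub, h.sub_eq, L.intervalIntegral_comp_comm (h.intervalIntegrable a b)]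

theorem sub [CompleteSpace E] {u' v' : ℝ → E} (h : IsPrimitive u v) (h' : IsPrimitive u' v') :
    IsPrimitive (fun t => u t - u' t) (fun t => v t - v' t) := by
  refine ⟨h.locallyIntegrable.sub h'.locallyIntegrable, fun a b => ?_⟩
  rw [intervalIntegral.integral_sub (h.intervalIntegrable a b) (h'.intervalIntegrable a b),
    ← h.sub_eq, ← h'.sub_eq]
  abel

/-- Grönwall's inequality for locally absolutely continuous functions. -/
theorem norm_le_of_norm_deriv_le (h : IsPrimitive u v) {a b K : ℝ} (hK : 0 ≤ K) {φ : ℝ → ℝ}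
    (hφ : IntervalIntegrable φ volume a b) (hφ0 : ∀ t, 0 ≤ φ t)
    (hv : ∀ᵐ t, ‖v t‖ ≤ K * ‖u t‖ + φ t) (ha : u a = 0) {t : ℝ} (ht : t ∈ Set.Icc a b) :
    ‖u t‖ ≤ Real.exp (K * (b - a)) * ∫ s in a..b, φ s := by
  have hab : a ≤ b := ht.1.trans ht.2
  set G : ℝ := ∫ s in a..b, φ s with hG
  have hG0 : 0 ≤ G := intervalIntegral.integral_nonneg hab fun s _ => hφ0 s
  have hc : Continuous fun s => K * ‖u s‖ := continuous_const.mul h.continuous.norm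
  -- ψ majorises ‖u‖ and is C¹ although u need not be, so the classical Grönwall inequality applies
  -- to ψ.
  set ψ : ℝ → ℝ := fun s => G + ∫ r in a..s, K * ‖u r‖ with hψ
  have hψd : ∀ s, HasDerivAt ψ (K * ‖u s‖) s := fun s =>
    (intervalIntegral.integral_hasDerivAt_right (hc.intervalIntegrable _ _)
      hc.stronglyMeasurable.stronglyMeasurableAtFilter hc.continuousAt).const_add _
  have hle : ∀ s ∈ Set.Icc a b, ‖u s‖ ≤ ψ s := by
    intro s hs
    have hφs : IntervalIntegrable φ volume a s := hφ.mono_set (by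
      rw [Set.uIcc_of_le hs.1, Set.uIcc_of_le hab]; exact Set.Icc_subset_Icc_right hs.2)
    have hφs' : IntervalIntegrable φ volume s b := hφ.mono_set (by
      rw [Set.uIcc_of_le hs.2, Set.uIcc_of_le hab]; exact Set.Icc_subset_Icc_left hs.1)
    have e : u s = ∫ r in a..s, v r := by rw [h.eq_add a s, ha, zero_add]
    have i1 : ‖∫ r in a..s, v r‖ ≤ ∫ r in a..s, (K * ‖u r‖ + φ r) :=
      intervalIntegral.norm_integral_le_of_norm_le hs.1 (hv.mono fun r hr _ => hr)
        ((hc.intervalIntegrable _ _).add hφs)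
    rw [intervalIntegral.integral_add (hc.intervalIntegrable _ _) hφs] at i1
    have i2 : ∫ r in a..s, φ r ≤ G := by
      rw [hG, ← intervalIntegral.integral_add_adjacent_intervals hφs hφs']
      have := intervalIntegral.integral_nonneg (μ := volume) hs.2 fun r _ => hφ0 r
      linarith
    rw [e]; simp only [hψ]; linarith
  have hmain := norm_le_gronwallBound_of_norm_deriv_right_le (f := ψ) (f' := fun s => K * ‖u s‖)
    (δ := G) (K := K) (ε := 0) (a := a) (b := b)
    (fun s _ => (hψd s).continuousAt.continuousWithinAt) (fun s _ => (hψd s).hasDerivWithinAt)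
    (by simp [hψ, abs_of_nonneg hG0]) (fun s hs => by
      rw [add_zero, Real.norm_eq_abs, abs_of_nonneg (by positivity)]
      exact mul_le_mul_of_nonneg_left
        ((hle s ⟨hs.1, hs.2.le⟩).trans (le_abs_self _)) hK) t ht
  rw [gronwallBound_ε0] at hmain
  refine (hle t ht).trans ((le_abs_self _).trans (hmain.trans ?_))
  rw [mul_comm]
  gcongr
  exact ht.2

end IsPrimitive

/-- The Cauchy–Schwarz inequality on an interval. -/
theorem sq_intervalIntegral_le {g : ℝ → ℝ} {a b : ℝ} (hab : a ≤ b)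
    (hg : IntervalIntegrable g volume a b)
    (hg2 : IntervalIntegrable (fun t => g t ^ 2) volume a b) :
    (∫ t in a..b, g t) ^ 2 ≤ (b - a) * ∫ t in a..b, g t ^ 2 := by
  rcases hab.eq_or_lt with rfl | hlt
  · simp
  have hT : 0 < b - a := sub_pos.2 hlt
  -- m is the mean of g; the inequality says that the variance is nonnegative.
  set m : ℝ := (∫ t in a..b, g t) / (b - a) with hm
  have h0 : 0 ≤ ∫ t in a..b, (g t - m) ^ 2 :=
    intervalIntegral.integral_nonneg hab fun t _ => sq_nonneg _
  have e : ∫ t in a..b, (g t - m) ^ 2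
      = (∫ t in a..b, g t ^ 2) - (2 * m) * (∫ t in a..b, g t) + (b - a) * m ^ 2 := by
    have : (fun t => (g t - m) ^ 2) = fun t => (g t ^ 2 - (2 * m) * g t) + m ^ 2 := by
      funext t; ring
    rw [this, intervalIntegral.integral_add (hg2.sub (hg.const_mul _)) (by simp),
      intervalIntegral.integral_sub hg2 (hg.const_mul _), intervalIntegral.integral_const_mul,
      intervalIntegral.integral_const, smul_eq_mul]
  have e2 : ∫ t in a..b, g t = m * (b - a) := by rw [hm]; field_simp
  rw [e, e2] at h0
  rw [e2]
  nlinarith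

/-- The Sobolev inequality on an interval. -/
theorem IsPrimitive.sq_norm_le {u v : ℝ → E} (h : IsPrimitive u v) {a T : ℝ} (hT : 0 ≤ T)
    (hv : IntervalIntegrable (fun t => ‖v t‖ ^ 2) volume a (a + T)) {s : ℝ}
    (hs : s ∈ Set.Icc a (a + T)) :
    T * ‖u s‖ ^ 2 ≤ 2 * (∫ t in a..a + T, ‖u t‖ ^ 2) + 2 * T ^ 2 * ∫ t in a..a + T, ‖v t‖ ^ 2 := by
  set V : ℝ := ∫ t in a..a + T, ‖v t‖ ^ 2 with hV
  have hab : a ≤ a + T := by linarith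
  have hvi := (h.intervalIntegrable a (a + T)).norm
  -- Compare the value at s with the value at every t of the interval, then integrate over t.
  have key : ∀ t ∈ Set.Icc a (a + T), ‖u s‖ ^ 2 ≤ 2 * ‖u t‖ ^ 2 + 2 * (T * V) := by
    intro t ht
    have h1 : ‖u s - u t‖ ≤ ∫ r in a..a + T, ‖v r‖ := by
      rw [h.sub_eq t s]
      refine (intervalIntegral.norm_integral_le_abs_integral_norm).trans ?_
      refine (intervalIntegral.abs_integral_mono_interval ?_
        (Eventually.of_forall fun r => norm_nonneg _) hvi).trans (le_of_eq (abs_of_nonneg ?_))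
      · rw [Set.uIoc_of_le hab]
        rcases le_total t s with hts | hts
        · rw [Set.uIoc_of_le hts]; exact Set.Ioc_subset_Ioc ht.1 hs.2
        · rw [Set.uIoc_of_ge hts]; exact Set.Ioc_subset_Ioc hs.1 ht.2
      · exact intervalIntegral.integral_nonneg hab fun r _ => norm_nonneg _
    have h2 := sq_intervalIntegral_le hab hvi hv
    rw [add_sub_cancel_left] at h2
    have h3 : ‖u s‖ ≤ ‖u t‖ + ∫ r in a..a + T, ‖v r‖ := by
      have := norm_add_le (u t) (u s - u t)
      rw [add_sub_cancel] at this
      linarith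
    calc ‖u s‖ ^ 2 ≤ (‖u t‖ + ∫ r in a..a + T, ‖v r‖) ^ 2 := by gcongr
      _ ≤ 2 * ‖u t‖ ^ 2 + 2 * (∫ r in a..a + T, ‖v r‖) ^ 2 := by
        nlinarith [sq_nonneg (‖u t‖ - ∫ r in a..a + T, ‖v r‖)]
      _ ≤ _ := by rw [hV]; linarith
  have hcu : Continuous fun t => ‖u t‖ ^ 2 := h.continuous.norm.pow 2
  have hint := intervalIntegral.integral_mono_on hab (f := fun _ => ‖u s‖ ^ 2)
    (g := fun t => 2 * ‖u t‖ ^ 2 + 2 * (T * V)) (μ := volume) (by simp)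
    (Continuous.intervalIntegrable (by fun_prop) _ _) key
  rw [intervalIntegral.integral_add ((hcu.intervalIntegrable _ _).const_mul 2) (by simp),
    intervalIntegral.integral_const_mul, intervalIntegral.integral_const,
    intervalIntegral.integral_const] at hint
  simp only [add_sub_cancel_left, smul_eq_mul] at hint
  linarith

/-- Integration by parts for real absolutely continuous functions. -/
theorem IsPrimitive.integral_mul_add_mul {f f' g g' : ℝ → ℝ} (hf : IsPrimitive f f')
    (hg : IsPrimitive g g') (a b : ℝ) :
    ∫ t in a..b, (f' t * g t + f t * g' t) = f b * g b - f a * g a := by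
  -- An indefinite integral is absolutely continuous and, by Lebesgue differentiation, its
  -- derivative is a.e. the integrand.
  have hac : ∀ {f f' : ℝ → ℝ}, IsPrimitive f f' → AbsolutelyContinuousOnInterval f a b := by
    intro f f' hf
    have h1 := (hf.intervalIntegrable a b).absolutelyContinuousOnInterval_intervalIntegral
      (c := a) (by simp)
    have h2 : AbsolutelyContinuousOnInterval (fun _ => f a) a b := by
      have := LipschitzOnWith.absolutelyContinuousOnInterval (K := 0) (f := fun _ => f a)
        (a := a) (b := b) (LipschitzWith.const _).lipschitzOnWith
      exact this
    have := h2.add h1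
    refine (congrArg (fun F => AbsolutelyContinuousOnInterval F a b) ?_).mpr this
    funext t
    exact hf.eq_add a t
  have hd : ∀ {f f' : ℝ → ℝ}, IsPrimitive f f' → ∀ᵐ t, deriv f t = f' t := by
    intro f f' hf
    filter_upwards [LocallyIntegrable.ae_hasDerivAt_integral hf.locallyIntegrable] with t ht
    have : f = fun b => f 0 + ∫ t in (0:ℝ)..b, f' t := funext fun b => hf.eq_add 0 b
    rw [this]
    exact ((ht 0).const_add _).deriv
  rw [← (hac hf).integral_deriv_mul_eq_sub (hac hg)]
  refine intervalIntegral.integral_congr_ae ?_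
  filter_upwards [hd hf, hd hg] with t h1 h2 _
  rw [h1, h2]

end Primitive

/-! ### Recursions on square summable bi-infinite sequences -/

section Discrete

theorem tsum_shift {f : ℤ → ℝ} (c : ℤ) : ∑' n, f (n + c) = ∑' n, f n :=
  (Equiv.addRight c).tsum_eq f

theorem summable_shift {f : ℤ → ℝ} (hf : Summable f) (c : ℤ) : Summable fun n => f (n + c) :=
  (Equiv.addRight c).summable_iff.2 hf

/-- A square summable bi-infinite sequence is controlled by its image under the shift minus a scalar
off the unit circle. -/
theorem tsum_sq_le_of_norm_ne_one {W : Type*} [NormedAddCommGroup W] [NormedSpace ℂ W] {ρ : ℂ}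
    {b : ℤ → W} (hb : Summable fun n => ‖b n‖ ^ 2) :
    (1 - ‖ρ‖) ^ 2 * ∑' n, ‖b n‖ ^ 2 ≤ ∑' n, ‖b (n + 1) - ρ • b n‖ ^ 2 := by
  set r := ‖ρ‖ with hr
  have hr0 : 0 ≤ r := norm_nonneg _
  have hb1 : Summable fun n => ‖b (n + 1)‖ ^ 2 := summable_shift hb 1
  have e1 : ∑' n, ‖b (n + 1)‖ ^ 2 = ∑' n, ‖b n‖ ^ 2 := tsum_shift (f := fun n => ‖b n‖ ^ 2) 1
  have hs : Summable fun n => ‖b (n + 1) - ρ • b n‖ ^ 2 := by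
    refine Summable.of_nonneg_of_le (fun n => by positivity) (fun n => ?_)
      ((hb1.mul_left 2).add (hb.mul_left (2 * r ^ 2)))
    have := norm_sub_le (b (n + 1)) (ρ • b n)
    rw [norm_smul] at this
    calc ‖b (n + 1) - ρ • b n‖ ^ 2 ≤ (‖b (n + 1)‖ + r * ‖b n‖) ^ 2 := by gcongr
      _ ≤ _ := by nlinarith [sq_nonneg (‖b (n + 1)‖ - r * ‖b n‖)]
  -- With β = ‖b (n + 1)‖ and α = ‖b n‖, the left side is (β - rα)² - r(β - α)². Summing, shift
  -- invariance merges the two coefficients into (1 - r) + (r² - r) = (1 - r)².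
  have hpt : ∀ n, (1 - r) * ‖b (n + 1)‖ ^ 2 + (r ^ 2 - r) * ‖b n‖ ^ 2
      ≤ ‖b (n + 1) - ρ • b n‖ ^ 2 := by
    intro n
    have := abs_norm_sub_norm_le (b (n + 1)) (ρ • b n)
    rw [norm_smul] at this
    have h2 : (‖b (n + 1)‖ - r * ‖b n‖) ^ 2 ≤ ‖b (n + 1) - ρ • b n‖ ^ 2 := by
      rw [← sq_abs]; gcongr
    nlinarith [mul_nonneg hr0 (sq_nonneg (‖b (n + 1)‖ - ‖b n‖))]
  have := Summable.tsum_le_tsum hpt ((hb1.mul_left _).add (hb.mul_left _)) hs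
  rw [(hb1.mul_left _).tsum_add (hb.mul_left _), tsum_mul_left, tsum_mul_left, e1] at this
  linarith

theorem summable_sq_norm_clm {𝕜 W W' : Type*} [NontriviallyNormedField 𝕜] [NormedAddCommGroup W]
    [NormedSpace 𝕜 W] [NormedAddCommGroup W'] [NormedSpace 𝕜 W'] (Q : W →L[𝕜] W') {a : ℤ → W}
    (ha : Summable fun n => ‖a n‖ ^ 2) : Summable fun n => ‖Q (a n)‖ ^ 2 := by
  refine Summable.of_nonneg_of_le (fun n => by positivity) (fun n => ?_) (ha.mul_left (‖Q‖ ^ 2))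
  rw [← mul_pow]
  gcongr
  exact Q.le_opNorm _

theorem summable_sq_norm_sub {W : Type*} [NormedAddCommGroup W] {a b : ℤ → W}
    (ha : Summable fun n => ‖a n‖ ^ 2) (hb : Summable fun n => ‖b n‖ ^ 2) :
    Summable fun n => ‖a n - b n‖ ^ 2 := by
  refine Summable.of_nonneg_of_le (fun n => by positivity) (fun n => ?_)
    ((ha.mul_left 2).add (hb.mul_left 2))
  calc ‖a n - b n‖ ^ 2 ≤ (‖a n‖ + ‖b n‖) ^ 2 := by gcongr; exact norm_sub_le _ _
    _ ≤ _ := by nlinarith [sq_nonneg (‖a n‖ - ‖b n‖)]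

/-- Induction on the number of factors P - ρ: the sequence Q(a n), with Q the product so far,
satisfies the scalar recursion with multiplier ρ up to the defect of a and the next product. The
extra term is there to vanish once the product is the characteristic polynomial of P evaluated at P.
-/
theorem exists_tsum_sq_le_add {W : Type*} [NormedAddCommGroup W] [NormedSpace ℂ W] (P : W →L[ℂ] W)
    (l : List ℂ) (hl : ∀ ρ ∈ l, ‖ρ‖ ≠ 1) :
    ∃ C : ℝ, 0 ≤ C ∧ ∀ a : ℤ → W, (Summable fun n => ‖a n‖ ^ 2) →
      ∑' n, ‖a n‖ ^ 2 ≤ C * ((∑' n, ‖a (n + 1) - P (a n)‖ ^ 2) +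
        ∑' n, ‖(l.map fun ρ => P - algebraMap ℂ (W →L[ℂ] W) ρ).prod (a n)‖ ^ 2) := by
  induction l with
  | nil =>
    refine ⟨1, zero_le_one, fun a ha => ?_⟩
    simp only [List.map_nil, List.prod_nil, one_apply_eq_self, one_mul]
    exact le_add_of_nonneg_left (tsum_nonneg fun n => by positivity)
  | cons ρ l ih =>
    obtain ⟨C, hC0, hC⟩ := ih fun σ hσ => hl σ (List.mem_cons_of_mem _ hσ)
    set Q := (l.map fun ρ => P - algebraMap ℂ (W →L[ℂ] W) ρ).prod with hQ
    have hcomm : Commute P Q := by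
      refine Commute.list_prod_right _ _ fun x hx => ?_
      obtain ⟨σ, -, rfl⟩ := List.mem_map.1 hx
      exact (Commute.refl P).sub_right (Algebra.commutes σ P).symm
    have hρ : 0 < (1 - ‖ρ‖) ^ 2 := by
      have : 1 - ‖ρ‖ ≠ 0 := sub_ne_zero.2 (hl ρ List.mem_cons_self).symm
      positivity
    set k := (1 - ‖ρ‖) ^ 2 with hk
    refine ⟨C * (1 + (2 * ‖Q‖ ^ 2 + 2) / k), by positivity, fun a ha => ?_⟩
    rw [List.map_cons, List.prod_cons]
    set R := (P - algebraMap ℂ (W →L[ℂ] W) ρ) * Q with hR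
    set d : ℤ → W := fun n => a (n + 1) - P (a n) with hd
    have hds : Summable fun n => ‖d n‖ ^ 2 :=
      summable_sq_norm_sub (summable_shift ha 1) (summable_sq_norm_clm P ha)
    have hQs := summable_sq_norm_clm Q ha
    have hRs := summable_sq_norm_clm R ha
    have hstep := tsum_sq_le_of_norm_ne_one (ρ := ρ) hQs
    have hle : ∑' n, ‖Q (a (n + 1)) - ρ • Q (a n)‖ ^ 2
        ≤ 2 * ‖Q‖ ^ 2 * (∑' n, ‖d n‖ ^ 2) + 2 * ∑' n, ‖R (a n)‖ ^ 2 := by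
      rw [← tsum_mul_left, ← tsum_mul_left, ← (hds.mul_left _).tsum_add (hRs.mul_left _)]
      refine Summable.tsum_le_tsum (fun n => ?_) (summable_sq_norm_sub (summable_shift hQs 1) ?_)
        ((hds.mul_left _).add (hRs.mul_left _))
      -- Here Q P = P Q is used: Q(a(n+1)) = Q(d n) + P Q(a n), and P - ρ applied to Q(a n) is R(a
      -- n).
      · have e : Q (a (n + 1)) - ρ • Q (a n) = Q (d n) + R (a n) := by
          have : P (Q (a n)) = Q (P (a n)) := congrArg (fun T => T (a n)) hcomm.eq
          simp only [hR, hd, mul_apply_eq_comp, sub_apply, map_sub,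
            Algebra.algebraMap_eq_smul_one, smul_apply,
            one_apply_eq_self, this]
          abel
        rw [e]
        have h1 := norm_add_le (Q (d n)) (R (a n))
        have h2 := Q.le_opNorm (d n)
        calc ‖Q (d n) + R (a n)‖ ^ 2 ≤ (‖Q‖ * ‖d n‖ + ‖R (a n)‖) ^ 2 := by gcongr; linarith
          _ ≤ _ := by nlinarith [sq_nonneg (‖Q‖ * ‖d n‖ - ‖R (a n)‖)]
      · simpa [norm_smul, mul_pow] using hQs.mul_left (‖ρ‖ ^ 2)
    have hD0 : 0 ≤ ∑' n, ‖d n‖ ^ 2 := tsum_nonneg fun n => by positivity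
    have hR0 : 0 ≤ ∑' n, ‖R (a n)‖ ^ 2 := tsum_nonneg fun n => by positivity
    set D := ∑' n, ‖d n‖ ^ 2 with hDdef
    set RR := ∑' n, ‖R (a n)‖ ^ 2 with hRdef
    have hq : ∑' n, ‖Q (a n)‖ ^ 2 ≤ (2 * ‖Q‖ ^ 2 + 2) / k * (D + RR) := by
      rw [div_mul_eq_mul_div, le_div_iff₀ hρ]
      nlinarith [mul_nonneg (sq_nonneg ‖Q‖) hR0]
    calc ∑' n, ‖a n‖ ^ 2 ≤ C * (D + ∑' n, ‖Q (a n)‖ ^ 2) := hC a ha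
      _ ≤ C * ((D + RR) + (2 * ‖Q‖ ^ 2 + 2) / k * (D + RR)) := by gcongr; linarith
      _ = _ := by ring

/-- Over ℂ the characteristic polynomial is a product of linear factors, so with the list of its
roots the product term is zero by Cayley–Hamilton. -/
theorem exists_tsum_sq_le_complex {ι : Type*} [Fintype ι] [DecidableEq ι] (A : Matrix ι ι ℂ)
    (hA : ∀ ρ : ℂ, A.charpoly.IsRoot ρ → ‖ρ‖ ≠ 1) :
    ∃ C : ℝ, 0 ≤ C ∧ ∀ a : ℤ → ι → ℂ, (Summable fun n => ‖a n‖ ^ 2) →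
      ∑' n, ‖a n‖ ^ 2 ≤ C * ∑' n, ‖a (n + 1) - A.mulVec (a n)‖ ^ 2 := by
  set P : (ι → ℂ) →L[ℂ] (ι → ℂ) := LinearMap.toContinuousLinearMap (Matrix.toLin' A) with hP
  obtain ⟨C, hC0, hC⟩ := exists_tsum_sq_le_add P A.charpoly.roots.toList fun ρ hρ =>
    hA ρ (Polynomial.isRoot_of_mem_roots (Multiset.mem_toList.1 hρ))
  refine ⟨C, hC0, fun a ha => ?_⟩
  have hzero : (A.charpoly.roots.toList.map
      fun ρ => P - algebraMap ℂ ((ι → ℂ) →L[ℂ] (ι → ℂ)) ρ).prod = 0 := by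
    have hsplit := (IsAlgClosed.splits A.charpoly).eq_prod_roots_of_monic A.charpoly_monic
    have hCH : Polynomial.aeval (Matrix.toLin' A) A.charpoly = 0 := by
      have := congrArg (Matrix.toLinAlgEquiv' (R := ℂ) (n := ι)) (Matrix.aeval_self_charpoly A)
      rw [← Polynomial.aeval_algHom_apply, map_zero] at this
      exact this
    have hl : A.charpoly = (A.charpoly.roots.toList.map
        fun ρ => Polynomial.X - Polynomial.C ρ).prod := by
      conv_lhs => rw [hsplit, ← Multiset.coe_toList A.charpoly.roots]
      rw [Multiset.map_coe, Multiset.prod_coe]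
    rw [hl, map_list_prod, List.map_map] at hCH
    have hcoe : ∀ l : List ℂ, (((l.map fun ρ => P - algebraMap ℂ ((ι → ℂ) →L[ℂ] (ι → ℂ)) ρ).prod :
        (ι → ℂ) →L[ℂ] (ι → ℂ)) : (ι → ℂ) →ₗ[ℂ] (ι → ℂ)) = (l.map
        (⇑(Polynomial.aeval (Matrix.toLin' A)) ∘ fun ρ => Polynomial.X - Polynomial.C ρ)).prod := by
      intro l
      induction l with
      | nil => rfl
      | cons ρ l ih =>
        rw [List.map_cons, List.prod_cons, List.map_cons, List.prod_cons, ← ih]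
        ext1 x
        simp [hP, Algebra.algebraMap_eq_smul_one]
    apply ContinuousLinearMap.coe_injective
    rw [hcoe, hCH]
    rfl
  have := hC a ha
  simp only [hzero, zero_apply, norm_zero] at this
  simpa [hP] using this

/-- If the linear operator `P` has no eigenvalue on the unit circle, then square summable
bi-infinite sequences are controlled by the defect in the recursion `a (n + 1) = P (a n)`. -/
theorem exists_tsum_sq_le {E : Type*} [NormedAddCommGroup E] [NormedSpace ℝ E]
    [FiniteDimensional ℝ E] (P : E →L[ℝ] E)
    (hP : ∀ ρ : ℂ, Polynomial.aeval ρ (LinearMap.charpoly (P : E →ₗ[ℝ] E)) = 0 → ‖ρ‖ ≠ 1) :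
    ∃ C : ℝ, 0 ≤ C ∧ ∀ a : ℤ → E, (Summable fun n => ‖a n‖ ^ 2) →
      ∑' n, ‖a n‖ ^ 2 ≤ C * ∑' n, ‖a (n + 1) - P (a n)‖ ^ 2 := by
  classical
  set b := Module.finBasis ℝ E with hb
  set A : Matrix _ _ ℝ := LinearMap.toMatrix b b (P : E →ₗ[ℝ] E) with hA
  obtain ⟨C, hC0, hC⟩ := exists_tsum_sq_le_complex (A.map (algebraMap ℝ ℂ)) fun ρ hρ => by
    apply hP
    rw [Matrix.charpoly_map, Polynomial.IsRoot, Polynomial.eval_map_algebraMap] at hρ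
    rwa [hA, LinearMap.charpoly_toMatrix] at hρ
  -- Complexification in coordinates: c is injective on a finite-dimensional space, hence bounded
  -- below, and intertwines P with its complexified matrix.
  set c : E →L[ℝ] (Fin (Module.finrank ℝ E) → ℂ) :=
    LinearMap.toContinuousLinearMap
      ((Complex.ofRealCLM.toLinearMap.compLeft _) ∘ₗ b.equivFun.toLinearMap) with hc
  have hcapp : ∀ x i, c x i = (b.repr x i : ℂ) := fun x i => rfl
  have hinj : Function.Injective c := by
    intro x y hxy
    apply b.repr.injective
    ext i
    have := congrFun hxy i
    rw [hcapp, hcapp] at this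
    exact_mod_cast this
  obtain ⟨K, -, hK⟩ := c.toLinearMap.exists_antilipschitzWith (LinearMap.ker_eq_bot.2 hinj)
  have hKn : ∀ x, ‖x‖ ≤ K * ‖c x‖ := fun x => by
    simpa using hK.le_mul_dist x 0
  have hcP : ∀ x, c (P x) = (A.map (algebraMap ℝ ℂ)).mulVec (c x) := by
    intro x
    funext i
    have h := congrFun (LinearMap.toMatrix_mulVec_repr b b (P : E →ₗ[ℝ] E) x) i
    have h' := congrArg (fun r : ℝ => (r : ℂ)) h
    simp only [Matrix.mulVec, dotProduct, Complex.ofReal_sum, Complex.ofReal_mul] at h'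
    rw [hcapp]
    simp only [Matrix.mulVec, dotProduct, Matrix.map_apply, hcapp]
    exact h'.symm
  refine ⟨K ^ 2 * (C * ‖c‖ ^ 2), by positivity, fun a ha => ?_⟩
  have hca := summable_sq_norm_clm c ha
  have hds : Summable fun n => ‖a (n + 1) - P (a n)‖ ^ 2 :=
    summable_sq_norm_sub (summable_shift ha 1) (summable_sq_norm_clm P ha)
  have h1 : ∑' n, ‖a n‖ ^ 2 ≤ K ^ 2 * ∑' n, ‖c (a n)‖ ^ 2 := by
    rw [← tsum_mul_left]
    refine Summable.tsum_le_tsum (fun n => ?_) ha (hca.mul_left _)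
    rw [← mul_pow]; gcongr; exact hKn _
  have h2 := hC (fun n => c (a n)) hca
  simp only [← hcP, ← map_sub] at h2
  have h3 : ∑' n, ‖c (a (n + 1) - P (a n))‖ ^ 2 ≤ ‖c‖ ^ 2 * ∑' n, ‖a (n + 1) - P (a n)‖ ^ 2 := by
    rw [← tsum_mul_left]
    refine Summable.tsum_le_tsum (fun n => ?_) (summable_sq_norm_clm c hds) (hds.mul_left _)
    rw [← mul_pow]; gcongr; exact c.le_opNorm _
  calc ∑' n, ‖a n‖ ^ 2 ≤ K ^ 2 * ∑' n, ‖c (a n)‖ ^ 2 := h1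
    _ ≤ K ^ 2 * (C * (‖c‖ ^ 2 * ∑' n, ‖a (n + 1) - P (a n)‖ ^ 2)) := by
      gcongr
      exact h2.trans (by gcongr)
    _ = _ := by ring

end Discrete

/-! ### Global solutions of linear differential equations -/

section LinearODE

variable {G : Type*} [NormedAddCommGroup G] [NormedSpace ℝ G]

/-- The estimate behind the contraction below: integrating k times the weight from 0, in either
direction, gives at most the weight. Negative t reduces to positive t by evenness. -/
theorem abs_integral_exp_abs_le {k : ℝ} (hk : 0 < k) (t : ℝ) :
    |∫ s in (0:ℝ)..t, k * Real.exp (k * |s|)| ≤ Real.exp (k * |t|) := by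
  have hd : ∀ s : ℝ, HasDerivAt (fun s => Real.exp (k * s)) (k * Real.exp (k * s)) s := fun s => by
    simpa [mul_comm] using ((hasDerivAt_id s).const_mul k).exp
  have hpos : ∀ r : ℝ, 0 ≤ r →
      ∫ s in (0:ℝ)..r, k * Real.exp (k * |s|) = Real.exp (k * r) - 1 := by
    intro r hr
    have : ∫ s in (0:ℝ)..r, k * Real.exp (k * |s|) = ∫ s in (0:ℝ)..r, k * Real.exp (k * s) := by
      refine intervalIntegral.integral_congr fun s hs => ?_
      rw [Set.uIcc_of_le hr] at hs
      simp only [abs_of_nonneg hs.1]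
    rw [this, intervalIntegral.integral_eq_sub_of_hasDerivAt (fun s _ => hd s)
      (Continuous.intervalIntegrable (by fun_prop) _ _)]
    simp
  rcases le_total 0 t with ht | ht
  · rw [hpos t ht, abs_of_nonneg ht, abs_of_nonneg (by
      have := Real.one_le_exp (mul_nonneg hk.le ht); linarith)]
    linarith
  · have h := hpos (-t) (by linarith)
    rw [← neg_zero, ← intervalIntegral.integral_comp_neg] at h
    simp only [abs_neg] at h
    rw [intervalIntegral.integral_symm] at h
    rw [← abs_neg, h, abs_of_nonpos ht, abs_of_nonneg (by
      have := Real.one_le_exp (mul_nonneg hk.le (neg_nonneg.2 ht)); linarith)]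
    linarith

/-- Global solvability of linear differential equations with bounded continuous coefficients. -/
theorem exists_linear_ode_solution [CompleteSpace G] {B : ℝ → G →L[ℝ] G} (hB : Continuous B) {K : ℝ}
    (hK : ∀ t, ‖B t‖ ≤ K) (x₀ : G) :
    ∃ x : ℝ → G, x 0 = x₀ ∧ ∀ t, HasDerivAt x (B t (x t)) t := by
  have hK0 : 0 ≤ K := (norm_nonneg _).trans (hK 0)
  -- Picard iteration in the sup norm weighted by exp(-k|t|): the unknown is z(t) = exp(-k|t|) x(t),
  -- and this k makes the contraction constant 1/2 on all of ℝ at once.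
  set k : ℝ := 2 * (K + 1) with hk
  have hkpos : 0 < k := by positivity
  set I : (ℝ → G) → ℝ → G := fun z t => ∫ s in (0:ℝ)..t, B s (Real.exp (k * |s|) • z s) with hI
  have hcont : ∀ z : ℝ → G, Continuous z → Continuous fun s => B s (Real.exp (k * |s|) • z s) :=
    fun z hz => hB.clm_apply (by fun_prop)
  have hIcont : ∀ z : ℝ → G, Continuous z → Continuous (I z) := fun z hz =>
    intervalIntegral.continuous_primitive (fun a b => (hcont z hz).intervalIntegrable a b) 0
  have hIle : ∀ (z : ℝ → G) (M : ℝ), 0 ≤ M → (∀ s, ‖z s‖ ≤ M) → ∀ t,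
      ‖I z t‖ ≤ M / 2 * Real.exp (k * |t|) := by
    intro z M hM hz t
    have h1 : ‖I z t‖ ≤ |∫ s in (0:ℝ)..t, M / 2 * (k * Real.exp (k * |s|))| := by
      refine intervalIntegral.norm_integral_le_abs_of_norm_le (Eventually.of_forall fun s => ?_)
        (Continuous.intervalIntegrable (by fun_prop) _ _)
      calc ‖B s (Real.exp (k * |s|) • z s)‖ ≤ K * (Real.exp (k * |s|) * M) := by
            refine (B s).le_of_opNorm_le_of_le (hK s) ?_
            rw [norm_smul, Real.norm_of_nonneg (Real.exp_pos _).le]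
            gcongr
            exact hz s
        _ ≤ (K + 1) * (Real.exp (k * |s|) * M) := by gcongr; linarith
        _ = _ := by rw [hk]; ring
    rw [intervalIntegral.integral_const_mul, abs_mul, abs_of_nonneg (by positivity)] at h1
    exact h1.trans (by gcongr; exact abs_integral_exp_abs_le hkpos t)
  have hw : ∀ t : ℝ, Real.exp (-(k * |t|)) * Real.exp (k * |t|) = 1 := fun t => by
    rw [← Real.exp_add]; simp
  have hbound : ∀ (z : ℝ → G) (M : ℝ), 0 ≤ M → (∀ s, ‖z s‖ ≤ M) → ∀ t,
      ‖Real.exp (-(k * |t|)) • I z t‖ ≤ M / 2 := by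
    intro z M hM hz t
    rw [norm_smul, Real.norm_of_nonneg (Real.exp_pos _).le]
    calc _ ≤ Real.exp (-(k * |t|)) * (M / 2 * Real.exp (k * |t|)) := by
          gcongr; exact hIle z M hM hz t
      _ = M / 2 * (Real.exp (-(k * |t|)) * Real.exp (k * |t|)) := by ring
      _ = M / 2 := by rw [hw, mul_one]
  let Φ : BoundedContinuousFunction ℝ G → BoundedContinuousFunction ℝ G := fun z =>
    BoundedContinuousFunction.ofNormedAddCommGroup
      (fun t => Real.exp (-(k * |t|)) • x₀ + Real.exp (-(k * |t|)) • I z t)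
      (by have := hIcont z z.continuous; fun_prop) (‖x₀‖ + ‖z‖ / 2) (fun t => by
        refine (norm_add_le _ _).trans (add_le_add ?_
          (hbound z ‖z‖ (norm_nonneg _) z.norm_coe_le_norm t))
        rw [norm_smul, Real.norm_of_nonneg (Real.exp_pos _).le]
        refine mul_le_of_le_one_left (norm_nonneg _) (Real.exp_le_one_iff.2 ?_)
        have := abs_nonneg t
        nlinarith)
  have hΦ : ContractingWith (1 / 2) Φ := by
    refine ⟨by rw [div_lt_one] <;> norm_num, LipschitzWith.of_dist_le_mul fun z z' => ?_⟩
    rw [BoundedContinuousFunction.dist_le (by positivity)]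
    intro t
    have e : Φ z t - Φ z' t = Real.exp (-(k * |t|)) • I (fun s => z s - z' s) t := by
      change (Real.exp (-(k * |t|)) • x₀ + Real.exp (-(k * |t|)) • I z t) -
        (Real.exp (-(k * |t|)) • x₀ + Real.exp (-(k * |t|)) • I z' t) = _
      rw [add_sub_add_left_eq_sub, ← smul_sub]
      congr 1
      simp only [hI, smul_sub, map_sub]
      rw [intervalIntegral.integral_sub ((hcont z z.continuous).intervalIntegrable _ _)
        ((hcont z' z'.continuous).intervalIntegrable _ _)]
    rw [dist_eq_norm, e]
    refine (hbound _ (dist z z') dist_nonneg (fun s => ?_) t).trans (le_of_eq ?_)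
    · rw [← dist_eq_norm]; exact BoundedContinuousFunction.dist_coe_le_dist s
    · push_cast; ring
  have hfix : Φ (hΦ.fixedPoint Φ) = hΦ.fixedPoint Φ := hΦ.fixedPoint_isFixedPt
  set z := hΦ.fixedPoint Φ with hz
  have hx : ∀ t, Real.exp (k * |t|) • z t = x₀ + I z t := by
    intro t
    have : z t = Real.exp (-(k * |t|)) • x₀ + Real.exp (-(k * |t|)) • I z t :=
      (DFunLike.congr_fun hfix t).symm
    rw [this, ← smul_add, smul_smul, mul_comm, hw, one_smul]
  refine ⟨fun t => Real.exp (k * |t|) • z t, ?_, fun t => ?_⟩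
  · change Real.exp (k * |0|) • z 0 = x₀
    rw [hx 0]; simp [hI]
  · have hc := hcont z z.continuous
    have h : HasDerivAt (fun t => x₀ + I z t) (B t (Real.exp (k * |t|) • z t)) t :=
      (intervalIntegral.integral_hasDerivAt_right (hc.intervalIntegrable _ _)
        hc.stronglyMeasurable.stronglyMeasurableAtFilter hc.continuousAt).const_add _
    exact h.congr_of_eventuallyEq (Eventually.of_forall hx)

end LinearODE

/-! ### The L² a priori bound for hyperbolic periodic systems -/

section Periodic

variable {E : Type*} [NormedAddCommGroup E] [NormedSpace ℝ E]

/-- The `L²` a priori bound `‖u‖² ≤ C ‖u' - B u‖²` for all `u ∈ H¹`. -/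
def HasL2Bound (B : ℝ → E →L[ℝ] E) (C : ℝ) : Prop :=
  ∀ u v : ℝ → E, IsPrimitive u v → MemLp u 2 volume → MemLp v 2 volume →
    ∫ t, ‖u t‖ ^ 2 ≤ C * ∫ t, ‖v t - B t (u t)‖ ^ 2

/-- Rescaling time by T reduces this to the decomposition of ℝ into unit intervals. -/
theorem hasSum_integral_period {g : ℝ → ℝ} (hg : Integrable g volume) {T : ℝ} (hT : 0 < T) :
    HasSum (fun n : ℤ => ∫ t in (n * T : ℝ)..n * T + T, g t) (∫ t, g t) := by
  have h1 : Integrable (fun t => g (t * T)) volume := hg.comp_mul_right' hT.ne'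
  have h2 := (h1.hasSum_intervalIntegral 0).mul_left T
  have e : ∫ t, g (t * T) = T⁻¹ * ∫ t, g t := by
    rw [Measure.integral_comp_mul_right, abs_of_pos (inv_pos.2 hT), smul_eq_mul]
  rw [e, mul_inv_cancel_left₀ hT.ne'] at h2
  have e2 : (fun n : ℤ => ∫ t in (n * T : ℝ)..n * T + T, g t)
      = fun n : ℤ => T * ∫ t in (0 + n : ℝ)..0 + n + 1, g (t * T) := by
    funext n
    rw [intervalIntegral.integral_comp_mul_right _ hT.ne', smul_eq_mul, mul_inv_cancel_left₀ hT.ne',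
      zero_add, add_mul, one_mul]
  rwa [e2]

theorem exists_norm_le_of_periodic {F : Type*} [NormedAddCommGroup F] {B : ℝ → F}
    (hB : Continuous B) {T : ℝ} (hT : 0 < T) (hp : Function.Periodic B T) :
    ∃ K : ℝ, 0 ≤ K ∧ ∀ t, ‖B t‖ ≤ K := by
  obtain ⟨K, hK⟩ := isCompact_Icc.exists_bound_of_continuousOn (s := Set.Icc 0 T) hB.continuousOn
  refine ⟨K, (norm_nonneg _).trans (hK 0 ⟨le_rfl, hT.le⟩), fun t => ?_⟩
  obtain ⟨s, hs, e⟩ := hp.exists_mem_Ico₀ hT t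
  rw [e]
  exact hK s ⟨hs.1, hs.2.le⟩

theorem memLp_clm_apply {B : ℝ → E →L[ℝ] E} (hB : Continuous B) {K : ℝ} (hK : ∀ t, ‖B t‖ ≤ K)
    {u : ℝ → E} (hu : MemLp u 2 volume) : MemLp (fun t => B t (u t)) 2 volume := by
  refine MemLp.of_le_mul (c := K) hu ?_ (Eventually.of_forall fun t => ?_)
  · exact (ContinuousLinearMap.apply ℝ E).flip.aestronglyMeasurable_comp₂ hB.aestronglyMeasurable hu.1
  · exact (B t).le_of_opNorm_le (hK t) _

/-- Systems with periodic coefficients and without characteristic multipliers on the unit circle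
satisfy the `L²` a priori bound. -/
theorem exists_hasL2Bound_of_periodic [FiniteDimensional ℝ E] {B : ℝ → E →L[ℝ] E}
    (hB : Continuous B) {T : ℝ} (hT : 0 < T) (hp : Function.Periodic B T)
    (hmult : ∀ X : ℝ → E →L[ℝ] E, X 0 = ContinuousLinearMap.id ℝ E →
      (∀ t, HasDerivAt X ((B t).comp (X t)) t) →
      ∀ ρ : ℂ, Polynomial.aeval ρ (LinearMap.charpoly (X T : E →ₗ[ℝ] E)) = 0 → ‖ρ‖ ≠ 1) :
    ∃ C : ℝ, 0 ≤ C ∧ HasL2Bound B C := by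
  obtain ⟨K, hK0, hK⟩ := exists_norm_le_of_periodic hB hT hp
  have hpn : ∀ (n : ℤ) (t : ℝ), B (t + n * T) = B t := fun n t => hp.int_mul n t
  -- The principal solution solves a linear equation in the space of operators, with left
  -- composition by B t as coefficient.
  obtain ⟨X, hX0, hX⟩ := exists_linear_ode_solution
    (B := fun t => ContinuousLinearMap.compL ℝ E E E (B t))
    ((ContinuousLinearMap.compL ℝ E E E).continuous.comp hB)
    (K := ‖ContinuousLinearMap.compL ℝ E E E‖ * K)
    (fun t => (ContinuousLinearMap.le_opNorm _ _).trans (by gcongr; exact hK t))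
    (ContinuousLinearMap.id ℝ E)
  have hXc : Continuous X := continuous_iff_continuousAt.2 fun t => (hX t).continuousAt
  obtain ⟨C, hC0, hC⟩ := exists_tsum_sq_le (X T) (hmult X hX0 hX)
  obtain ⟨M, hM⟩ := isCompact_Icc.exists_bound_of_continuousOn (s := Set.Icc 0 T) hXc.continuousOn
  have hM0 : 0 ≤ M := (norm_nonneg _).trans (hM 0 ⟨le_rfl, hT.le⟩)
  -- The squared Grönwall factor for one period, times the factor T from the Cauchy–Schwarz
  -- inequality.
  set κ : ℝ := Real.exp (K * T) ^ 2 * T with hκ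
  have hκ0 : 0 ≤ κ := by positivity
  refine ⟨2 * T * M ^ 2 * (C * κ) + 2 * T * κ, by positivity, fun u v h hu hv => ?_⟩
  set f : ℝ → E := fun t => v t - B t (u t) with hf
  have hfL : MemLp f 2 volume := hv.sub (memLp_clm_apply hB hK hu)
  have hu2 : Integrable (fun t => ‖u t‖ ^ 2) volume := (memLp_two_iff_integrable_sq_norm hu.1).1 hu
  have hv2 : Integrable (fun t => ‖v t‖ ^ 2) volume := (memLp_two_iff_integrable_sq_norm hv.1).1 hv
  have hf2 : Integrable (fun t => ‖f t‖ ^ 2) volume :=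
    (memLp_two_iff_integrable_sq_norm hfL.1).1 hfL
  have hfloc : LocallyIntegrable f volume := hfL.locallyIntegrable (by norm_num)
  have hfn : ∀ a b, IntervalIntegrable (fun t => ‖f t‖) volume a b := fun a b =>
    (hfloc.integrableOn_isCompact isCompact_uIcc).intervalIntegrable.norm
  have hsU := hasSum_integral_period hu2 hT
  have hsV := hasSum_integral_period hv2 hT
  have hsF := hasSum_integral_period hf2 hT
  -- By periodicity, the translate of u and X(t) u(nT) satisfy the same equation up to f and agree
  -- at t = 0, so Grönwall bounds their difference by f on that period.
  have hdefect : ∀ (n : ℤ), ∀ t ∈ Set.Icc 0 T, ‖u (t + n * T) - X t (u (n * T))‖ ^ 2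
      ≤ κ * ∫ t in (n * T : ℝ)..n * T + T, ‖f t‖ ^ 2 := by
    intro n t ht
    have hXu : IsPrimitive (fun t => X t (u (n * T))) (fun t => B t (X t (u (n * T)))) :=
      IsPrimitive.of_hasDerivAt (fun s => ((ContinuousLinearMap.apply ℝ E (u (n * T))).hasFDerivAt
        (x := X s)).comp_hasDerivAt s (hX s)) (by fun_prop)
    have hw := (h.comp_add (n * T)).sub hXu
    have hG := hw.norm_le_of_norm_deriv_le (a := 0) (b := T) hK0
      (φ := fun t => ‖f (t + n * T)‖)
      (by simpa using (hfn (0 + n * T) (T + n * T)).comp_add_right (c := n * T)) (fun _ => norm_nonneg _)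
      (Eventually.of_forall fun s => ?_) (by simp [hX0]) ht
    · rw [intervalIntegral.integral_comp_add_right (fun t => ‖f t‖), zero_add, sub_zero,
        add_comm T] at hG
      have hcs := sq_intervalIntegral_le (a := n * T) (b := n * T + T) (by linarith) (hfn _ _)
        hf2.intervalIntegrable
      rw [add_sub_cancel_left] at hcs
      calc _ ≤ (Real.exp (K * T) * ∫ t in (n * T : ℝ)..n * T + T, ‖f t‖) ^ 2 := by gcongr
        _ = Real.exp (K * T) ^ 2 * (∫ t in (n * T : ℝ)..n * T + T, ‖f t‖) ^ 2 := by ring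
        _ ≤ Real.exp (K * T) ^ 2 * (T * ∫ t in (n * T : ℝ)..n * T + T, ‖f t‖ ^ 2) := by gcongr
        _ = _ := by rw [hκ]; ring
    · have e : v (s + n * T) - B s (X s (u (n * T)))
          = B s (u (s + n * T) - X s (u (n * T))) + f (s + n * T) := by
        simp only [hf, map_sub, hpn]; abel
      rw [e]
      exact (norm_add_le _ _).trans (add_le_add ((B s).le_of_opNorm_le (hK s) _) le_rfl)
  -- The Sobolev inequality on each period makes the samples square summable, as the discrete
  -- estimate requires.
  have hsum : Summable fun n : ℤ => ‖u (n * T)‖ ^ 2 := by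
    refine Summable.of_nonneg_of_le (fun n => by positivity) (fun n => ?_)
      (((hsU.summable.mul_left 2).add (hsV.summable.mul_left (2 * T ^ 2))).mul_left T⁻¹)
    rw [inv_mul_eq_div, le_div_iff₀ hT, mul_comm]
    exact h.sq_norm_le hT.le hv2.intervalIntegrable ⟨le_rfl, by linarith⟩
  have hsd : ∑' n : ℤ, ‖u (n * T)‖ ^ 2 ≤ C * (κ * ∫ t, ‖f t‖ ^ 2) := by
    refine (hC (fun n => u (n * T)) hsum).trans ?_
    gcongr
    rw [← hsF.tsum_eq, ← tsum_mul_left]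
    refine Summable.tsum_le_tsum (fun n => ?_)
      (summable_sq_norm_sub (summable_shift hsum 1) (summable_sq_norm_clm (X T) hsum))
      (hsF.summable.mul_left κ)
    have := hdefect n T ⟨hT.le, le_rfl⟩
    rwa [show T + n * T = ((n + 1 : ℤ) : ℝ) * T by push_cast; ring] at this
  -- Back from samples to the function: on each period u is X(t) u(nT) plus the defect.
  have hU : ∀ n : ℤ, ∫ t in (n * T : ℝ)..n * T + T, ‖u t‖ ^ 2
      ≤ 2 * T * M ^ 2 * ‖u (n * T)‖ ^ 2 + 2 * T * κ * ∫ t in (n * T : ℝ)..n * T + T, ‖f t‖ ^ 2 := by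
    intro n
    set Fn := ∫ t in (n * T : ℝ)..n * T + T, ‖f t‖ ^ 2 with hFn
    have hpt : ∀ t ∈ Set.Icc (n * T : ℝ) (n * T + T), ‖u t‖ ^ 2
        ≤ 2 * M ^ 2 * ‖u (n * T)‖ ^ 2 + 2 * (κ * Fn) := by
      intro t ht
      have ht' : t - n * T ∈ Set.Icc 0 T := ⟨by linarith [ht.1], by linarith [ht.2]⟩
      have h1 := hdefect n _ ht'
      rw [sub_add_cancel] at h1
      have h2 := (X (t - n * T)).le_of_opNorm_le (hM _ ht') (u (n * T))
      have h3 := norm_add_le (u t - X (t - n * T) (u (n * T))) (X (t - n * T) (u (n * T)))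
      rw [sub_add_cancel] at h3
      set y := ‖u t - X (t - n * T) (u (n * T))‖
      calc ‖u t‖ ^ 2 ≤ (y + M * ‖u (n * T)‖) ^ 2 := by gcongr; linarith
        _ ≤ 2 * M ^ 2 * ‖u (n * T)‖ ^ 2 + 2 * y ^ 2 := by
          nlinarith [sq_nonneg (y - M * ‖u (n * T)‖)]
        _ ≤ _ := by linarith
    have := intervalIntegral.integral_mono_on (by linarith : n * T ≤ n * T + T)
      hu2.intervalIntegrable (by simp) hpt
    rw [intervalIntegral.integral_const, add_sub_cancel_left, smul_eq_mul] at this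
    linarith
  have hfin := Summable.tsum_le_tsum hU hsU.summable
    ((hsum.mul_left _).add (hsF.summable.mul_left _))
  rw [(hsum.mul_left _).tsum_add (hsF.summable.mul_left _), tsum_mul_left, tsum_mul_left,
    hsU.tsum_eq, hsF.tsum_eq] at hfin
  refine hfin.trans ?_
  have : 2 * T * M ^ 2 * ∑' n : ℤ, ‖u (n * T)‖ ^ 2
      ≤ 2 * T * M ^ 2 * (C * (κ * ∫ t, ‖f t‖ ^ 2)) := by gcongr
  linarith

end Periodic

/-! ### Perturbation to asymptotically periodic coefficients -/

section Asymptotic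

variable {E : Type*} [NormedAddCommGroup E] [NormedSpace ℝ E]

theorem sq_norm_add_le {F : Type*} [SeminormedAddCommGroup F] (x y : F) :
    ‖x + y‖ ^ 2 ≤ 2 * ‖x‖ ^ 2 + 2 * ‖y‖ ^ 2 := by
  have h := norm_add_le x y
  have h2 : ‖x + y‖ ^ 2 ≤ (‖x‖ + ‖y‖) ^ 2 := by gcongr
  nlinarith [sq_nonneg (‖x‖ - ‖y‖)]

/-- Time reversal, which reduces every statement at -∞ to the one at +∞. -/
theorem HasL2Bound.comp_neg {B : ℝ → E →L[ℝ] E} {C : ℝ} (h : HasL2Bound B C) :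
    HasL2Bound (fun t => -B (-t)) C := by
  intro u v huv hu hv
  have hm := Measure.measurePreserving_neg (volume : Measure ℝ)
  have := h _ _ huv.comp_neg (hu.comp_measurePreserving hm) (hv.comp_measurePreserving hm).neg
  rw [integral_neg_eq_self (fun t => ‖u t‖ ^ 2)] at this
  refine this.trans (le_of_eq ?_)
  rw [← integral_neg_eq_self (fun t => ‖v t - (-B (-t)) (u t)‖ ^ 2)]
  congr 2
  funext t
  rw [neg_neg, ← norm_neg]
  simp [add_comm, sub_eq_add_neg]

/-- The `L²` bound persists on a half-line on which the coefficients are close to those of the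
limiting system. -/
theorem HasL2Bound.setIntegral_Ioi_le {B B' : ℝ → E →L[ℝ] E} {C : ℝ} (hB' : HasL2Bound B' C)
    (hC : 0 ≤ C) {R ε : ℝ} (hε : 4 * C * ε ^ 2 ≤ 1) (hBB' : ∀ t, R < t → ‖B t - B' t‖ ≤ ε)
    {u v : ℝ → E} (h : IsPrimitive u v) (hu : MemLp u 2 volume) (hv : MemLp v 2 volume)
    (hf : Integrable (fun t => ‖v t - B t (u t)‖ ^ 2) volume) (hR : u R = 0) :
    ∫ t in Set.Ioi R, ‖u t‖ ^ 2 ≤ 4 * C * ∫ t in Set.Ioi R, ‖v t - B t (u t)‖ ^ 2 := by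
  have hu2 : Integrable (fun t => ‖u t‖ ^ 2) volume := (memLp_two_iff_integrable_sq_norm hu.1).1 hu
  have hmain := hB' _ _ (h.indicator_Ioi hR) (hu.indicator measurableSet_Ioi)
    (hv.indicator measurableSet_Ioi)
  have e1 : (fun t => ‖(Set.Ioi R).indicator u t‖ ^ 2)
      = (Set.Ioi R).indicator fun t => ‖u t‖ ^ 2 := by
    funext t; by_cases ht : t ∈ Set.Ioi R <;> simp [ht]
  have e2 : (fun t => ‖(Set.Ioi R).indicator v t - B' t ((Set.Ioi R).indicator u t)‖ ^ 2)
      = (Set.Ioi R).indicator fun t => ‖v t - B' t (u t)‖ ^ 2 := by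
    funext t; by_cases ht : t ∈ Set.Ioi R <;> simp [ht]
  rw [e1, e2, integral_indicator measurableSet_Ioi, integral_indicator measurableSet_Ioi] at hmain
  -- Replacing B' by B costs 2ε²‖u‖². After multiplication by C, the condition 4Cε² ≤ 1 bounds this
  -- cost by half of the left side, which absorbs it and leaves the constant 4C.
  have hle : ∫ t in Set.Ioi R, ‖v t - B' t (u t)‖ ^ 2
      ≤ ∫ t in Set.Ioi R, (2 * ‖v t - B t (u t)‖ ^ 2 + 2 * ε ^ 2 * ‖u t‖ ^ 2) := by
    refine integral_mono_of_nonneg (Eventually.of_forall fun t => by positivity)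
      (((hf.const_mul 2).add (hu2.const_mul _)).integrableOn) ?_
    refine (ae_restrict_iff' measurableSet_Ioi).2 (Eventually.of_forall fun t ht => ?_)
    have e : v t - B' t (u t) = (v t - B t (u t)) + (B t - B' t) (u t) := by
      simp
    have h1 := (B t - B' t).le_of_opNorm_le (hBB' t ht) (u t)
    have h2 := sq_norm_add_le (v t - B t (u t)) ((B t - B' t) (u t))
    have h3 : ‖(B t - B' t) (u t)‖ ^ 2 ≤ (ε * ‖u t‖) ^ 2 := by gcongr
    simp only [e]
    linarith [mul_pow ε ‖u t‖ 2]
  rw [integral_add (hf.const_mul 2).integrableOn (hu2.const_mul _).integrableOn,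
    integral_const_mul, integral_const_mul] at hle
  have hU0 : 0 ≤ ∫ t in Set.Ioi R, ‖u t‖ ^ 2 := integral_nonneg fun t => by positivity
  nlinarith [mul_le_mul_of_nonneg_left hle hC, mul_le_mul_of_nonneg_right hε hU0]

theorem exists_forall_norm_sub_le {B B' : ℝ → E →L[ℝ] E} {C : ℝ} (hC : 0 ≤ C)
    (h : Tendsto (fun t => B t - B' t) atTop (𝓝 0)) :
    ∃ R ε : ℝ, 0 < R ∧ 4 * C * ε ^ 2 ≤ 1 ∧ ∀ t, R ≤ t → ‖B t - B' t‖ ≤ ε := by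
  -- With this choice 4Cε² = C/(C + 1)² ≤ 1, and ε is positive even when C = 0.
  set ε : ℝ := 1 / (2 * (C + 1)) with hε
  have hε0 : 0 < ε := by positivity
  have h1 : ∀ᶠ t in atTop, ‖B t - B' t‖ < ε := by
    have := h.norm
    rw [norm_zero] at this
    exact this.eventually_lt_const hε0
  obtain ⟨R, hR⟩ := eventually_atTop.1 h1
  refine ⟨max R 1, ε, by positivity, ?_, fun t ht => (hR t ((le_max_left _ _).trans ht)).le⟩
  have : ε ^ 2 = 1 / (4 * (C + 1) ^ 2) := by rw [hε]; field_simp; norm_num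
  rw [this, mul_one_div, div_le_one (by positivity)]
  nlinarith

/-- An asymptotically controlled system is bounded below on the functions that vanish at two points
near `±∞`. -/
theorem exists_bound_of_vanishing {B Bp Bm : ℝ → E →L[ℝ] E} (hB : Continuous B) {K : ℝ}
    (hK : ∀ t, ‖B t‖ ≤ K) {Cp Cm : ℝ} (hCp : 0 ≤ Cp) (hCm : 0 ≤ Cm) (hBp : HasL2Bound Bp Cp)
    (hBm : HasL2Bound Bm Cm) (hp : Tendsto (fun t => B t - Bp t) atTop (𝓝 0))
    (hm : Tendsto (fun t => B t - Bm t) atBot (𝓝 0)) :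
    ∃ R₁ R₂ C : ℝ, 0 ≤ C ∧ ∀ u v : ℝ → E, IsPrimitive u v → MemLp u 2 volume → MemLp v 2 volume →
      u R₁ = 0 → u R₂ = 0 → ∫ t, ‖u t‖ ^ 2 ≤ C * ∫ t, ‖v t - B t (u t)‖ ^ 2 := by
  have hK0 : 0 ≤ K := (norm_nonneg _).trans (hK 0)
  obtain ⟨R₂, ε₂, hR₂, hε₂, hb₂⟩ := exists_forall_norm_sub_le hCp hp
  obtain ⟨R₁, ε₁, hR₁, hε₁, hb₁⟩ := exists_forall_norm_sub_le (B := fun t => -B (-t))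
    (B' := fun t => -Bm (-t)) hCm (by
      have := (hm.comp tendsto_neg_atTop_atBot).neg
      rw [neg_zero] at this
      refine this.congr fun t => ?_
      simp only [Function.comp]
      abel)
  have hR : -R₁ ≤ R₂ := by linarith
  -- R₁ is a threshold for the reversed system, so the left point is -R₁. As in the periodic case, κ
  -- combines Grönwall and Cauchy–Schwarz, here on [-R₁, R₂].
  set κ : ℝ := Real.exp (K * (R₂ - -R₁)) ^ 2 * (R₂ - -R₁) with hκ
  have hκ0 : 0 ≤ κ := mul_nonneg (by positivity) (by linarith)
  refine ⟨-R₁, R₂, 4 * Cm + (R₂ - -R₁) * κ + 4 * Cp, by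
    have := mul_nonneg (sub_nonneg.2 hR) hκ0
    positivity, fun u v h hu hv hu1 hu2 => ?_⟩
  have hfL : MemLp (fun t => v t - B t (u t)) 2 volume := hv.sub (memLp_clm_apply hB hK hu)
  have hf2 : Integrable (fun t => ‖v t - B t (u t)‖ ^ 2) volume :=
    (memLp_two_iff_integrable_sq_norm hfL.1).1 hfL
  have hui : Integrable (fun t => ‖u t‖ ^ 2) volume :=
    (memLp_two_iff_integrable_sq_norm hu.1).1 hu
  have hfn : IntervalIntegrable (fun t => ‖v t - B t (u t)‖) volume (-R₁) R₂ :=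
    ((hfL.locallyIntegrable (by norm_num)).integrableOn_isCompact
      isCompact_uIcc).intervalIntegrable.norm
  have hright := hBp.setIntegral_Ioi_le hCp hε₂ (fun t ht => hb₂ t ht.le) h hu hv hf2 hu2
  have hneg := Measure.measurePreserving_neg (volume : Measure ℝ)
  have efn : (fun t => ‖-v (-t) - (-B (-t)) (u (-t))‖ ^ 2)
      = fun t => ‖v (-t) - B (-t) (u (-t))‖ ^ 2 := by
    funext t
    rw [← norm_neg]
    simp [add_comm, sub_eq_add_neg]
  have hleft := hBm.comp_neg.setIntegral_Ioi_le hCm hε₁ (fun t ht => hb₁ t ht.le) h.comp_neg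
    (hu.comp_measurePreserving hneg) (hv.comp_measurePreserving hneg).neg
    (by rw [efn]; exact hf2.comp_neg) hu1
  rw [efn, integral_comp_neg_Ioi R₁ (fun t => ‖u t‖ ^ 2),
    integral_comp_neg_Ioi R₁ (fun t => ‖v t - B t (u t)‖ ^ 2)] at hleft
  have hcs := sq_intervalIntegral_le hR hfn hf2.intervalIntegrable
  -- Between the two points no hyperbolicity is needed: Grönwall starts from the zero at -R₁.
  have hpt : ∀ t ∈ Set.Icc (-R₁) R₂, ‖u t‖ ^ 2 ≤ κ * ∫ t in (-R₁)..R₂, ‖v t - B t (u t)‖ ^ 2 := by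
    intro t ht
    have hG := h.norm_le_of_norm_deriv_le hK0 hfn (fun _ => norm_nonneg _)
      (Eventually.of_forall fun s => by
        have := norm_add_le (B s (u s)) (v s - B s (u s))
        rw [add_sub_cancel] at this
        exact this.trans (add_le_add ((B s).le_of_opNorm_le (hK s) _) le_rfl)) hu1 ht
    calc ‖u t‖ ^ 2 ≤ (Real.exp (K * (R₂ - -R₁)) * ∫ s in (-R₁)..R₂, ‖v s - B s (u s)‖) ^ 2 := by
          gcongr
      _ ≤ Real.exp (K * (R₂ - -R₁)) ^ 2 * ((R₂ - -R₁) *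
          ∫ t in (-R₁)..R₂, ‖v t - B t (u t)‖ ^ 2) := by rw [mul_pow]; gcongr
      _ = _ := by rw [hκ]; ring
  have hmid := intervalIntegral.integral_mono_on hR hui.intervalIntegrable (by simp) hpt
  rw [intervalIntegral.integral_const, smul_eq_mul] at hmid
  have hsplit : ∀ g : ℝ → ℝ, Integrable g volume → ∫ t, g t
      = (∫ t in Set.Iic (-R₁), g t) + (∫ t in (-R₁)..R₂, g t) + ∫ t in Set.Ioi R₂, g t := by
    intro g hg
    rw [← intervalIntegral.integral_Iic_sub_Iic hg.integrableOn hg.integrableOn,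
      add_sub_cancel, intervalIntegral.integral_Iic_add_Ioi hg.integrableOn hg.integrableOn]
  have hfs := hsplit _ hf2
  have hnn : ∀ s : Set ℝ, 0 ≤ ∫ t in s, ‖v t - B t (u t)‖ ^ 2 := fun s =>
    integral_nonneg fun t => by positivity
  have hnn2 : 0 ≤ ∫ t in (-R₁)..R₂, ‖v t - B t (u t)‖ ^ 2 :=
    intervalIntegral.integral_nonneg hR fun t _ => by positivity
  have h1 := hnn (Set.Iic (-R₁))
  have h2 := hnn (Set.Ioi R₂)
  have h3 : 0 ≤ (R₂ - -R₁) * κ := mul_nonneg (sub_nonneg.2 hR) hκ0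
  rw [hsplit _ hui, hfs]
  set a := ∫ t in Set.Iic (-R₁), ‖v t - B t (u t)‖ ^ 2
  set b := ∫ t in (-R₁)..R₂, ‖v t - B t (u t)‖ ^ 2
  set c := ∫ t in Set.Ioi R₂, ‖v t - B t (u t)‖ ^ 2
  set w := (R₂ - -R₁) * κ
  have hmid' : ∫ t in (-R₁)..R₂, ‖u t‖ ^ 2 ≤ w * b := by linarith
  nlinarith [mul_nonneg hCm hnn2, mul_nonneg hCm h2, mul_nonneg h3 h1, mul_nonneg h3 h2,
    mul_nonneg hCp h1, mul_nonneg hCp hnn2]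

end Asymptotic

/-! ### Exponential decay of solutions tending to zero -/

section Decay

/-- The transition is locally constant off [0, 1]. Keeping the indicator in the bound confines the
cutoff error to unit intervals at the two ends. -/
theorem exists_abs_deriv_smoothTransition_le :
    ∃ c : ℝ, 0 ≤ c ∧ ∀ x, |deriv Real.smoothTransition x| ≤ c * (Set.Icc (0:ℝ) 1).indicator 1 x := by
  have hc : Continuous (deriv Real.smoothTransition) :=
    (Real.smoothTransition.contDiff (n := 1)).continuous_deriv le_rfl
  obtain ⟨c, hc'⟩ := isCompact_Icc.exists_bound_of_continuousOn (s := Set.Icc (0:ℝ) 1)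
    hc.continuousOn
  refine ⟨c, (norm_nonneg _).trans (hc' 0 ⟨le_rfl, zero_le_one⟩), fun x => ?_⟩
  by_cases hx : x ∈ Set.Icc (0:ℝ) 1
  · simpa [hx] using hc' x hx
  · rw [Set.indicator_of_notMem hx, mul_zero]
    have : deriv Real.smoothTransition x = 0 := by
      rcases not_and_or.1 hx with h | h
      · have : Real.smoothTransition =ᶠ[𝓝 x] fun _ => 0 := by
          filter_upwards [Iio_mem_nhds (not_le.1 h)] with y hy
          exact Real.smoothTransition.zero_of_nonpos (le_of_lt hy)
        rw [this.deriv_eq]; simp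
      · have : Real.smoothTransition =ᶠ[𝓝 x] fun _ => 1 := by
          filter_upwards [Ioi_mem_nhds (not_le.1 h)] with y hy
          exact Real.smoothTransition.one_of_one_le (le_of_lt hy)
        rw [this.deriv_eq]; simp
    simp [this]

variable {E : Type*} [NormedAddCommGroup E] [NormedSpace ℝ E]

/-- Solutions of an asymptotically controlled system have small mass in the middle of long intervals. -/
theorem exists_integral_le_boundary [CompleteSpace E] {B B' : ℝ → E →L[ℝ] E} (hB : Continuous B)
    {C : ℝ} (hC : 0 ≤ C) (hB' : HasL2Bound B' C)
    (hlim : Tendsto (fun t => B t - B' t) atTop (𝓝 0)) :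
    ∃ R κ : ℝ, 0 < κ ∧ ∀ u : ℝ → E, (∀ t, HasDerivAt u (B t (u t)) t) →
      ∀ s M : ℝ, R ≤ s → s + 2 ≤ M → ∫ t in (s + 1)..(M - 1), ‖u t‖ ^ 2
        ≤ κ * ((∫ t in s..(s + 1), ‖u t‖ ^ 2) + ∫ t in (M - 1)..M, ‖u t‖ ^ 2) := by
  obtain ⟨c, hc0, hc⟩ := exists_abs_deriv_smoothTransition_le
  obtain ⟨R, ε, -, hε, hb⟩ := exists_forall_norm_sub_le hC hlim
  -- The bound gives Y ≤ 2Cε²Y + 4Cc²(i + j), where Y is the mass of the cut-off solution and i, j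
  -- the masses at the ends. Absorbing half of Y yields 8Cc²; the added 1 only makes the constant
  -- positive.
  refine ⟨R, 8 * C * c ^ 2 + 1, by positivity, fun u hu s M hs hM => ?_⟩
  have huc : Continuous u := continuous_iff_continuousAt.2 fun t => (hu t).continuousAt
  set p := Real.smoothTransition with hp
  have hpc : Continuous p := Real.smoothTransition.continuous
  have hp1 : ContDiff ℝ 1 p := Real.smoothTransition.contDiff
  have hp'c : Continuous (deriv p) := hp1.continuous_deriv le_rfl
  have hpd : ∀ x, HasDerivAt p (deriv p x) x := fun x =>
    (hp1.differentiable one_ne_zero x).hasDerivAt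
  have hp0 : ∀ x, x ≤ 0 → p x = 0 := fun x => Real.smoothTransition.zero_of_nonpos
  have hp01 : ∀ x, |p x| ≤ 1 := fun x => by
    rw [abs_of_nonneg (Real.smoothTransition.nonneg x)]; exact Real.smoothTransition.le_one x
  -- χ vanishes off [s, M] and equals 1 on [s + 1, M - 1]. Since u solves the equation, (χu)' - Bχu
  -- = χ'u lives only near the ends.
  set χ : ℝ → ℝ := fun t => p (t - s) * p (M - t) with hχ
  set χ' : ℝ → ℝ := fun t => deriv p (t - s) * p (M - t) - p (t - s) * deriv p (M - t) with hχ'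
  have hχd : ∀ t, HasDerivAt χ (χ' t) t := by
    intro t
    have h1 : HasDerivAt (fun t => p (t - s)) (deriv p (t - s)) t := by
      exact (hpd (t - s)).comp_sub_const t s
    have h2 : HasDerivAt (fun t => p (M - t)) (-deriv p (M - t)) t := by
      exact (hpd (M - t)).comp_const_sub M t
    have := h1.mul h2
    refine this.congr_deriv ?_
    simp only [hχ']; ring
  have hχc : Continuous χ := by fun_prop
  have hχ'c : Continuous χ' := by fun_prop
  have hχ0 : ∀ t, t ∉ Set.Icc s M → χ t = 0 := by
    intro t ht
    rcases not_and_or.1 ht with h | h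
    · simp only [hχ]
      rw [hp0 (t - s) (by linarith [not_le.1 h]), zero_mul]
    · simp only [hχ]
      rw [hp0 (M - t) (by linarith [not_le.1 h]), mul_zero]
  have hχ'0 : ∀ t, t ∉ Set.Icc s M → χ' t = 0 := by
    intro t ht
    have h1 := hc (t - s)
    have h2 := hc (M - t)
    rcases not_and_or.1 ht with h | h
    · rw [Set.indicator_of_notMem (by simp; intro h'; exact absurd h' h), mul_zero, abs_nonpos_iff] at h1
      simp only [hχ']
      rw [h1, hp0 (t - s) (by linarith [not_le.1 h])]; ring
    · rw [Set.indicator_of_notMem (by simp; intro h'; exact absurd h' h), mul_zero, abs_nonpos_iff] at h2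
      simp only [hχ']
      rw [h2, hp0 (M - t) (by linarith [not_le.1 h])]; ring
  have hχ'sq : ∀ t, χ' t ^ 2 * ‖u t‖ ^ 2 ≤
      (Set.Icc s (s + 1)).indicator (fun t => 2 * c ^ 2 * ‖u t‖ ^ 2) t +
      (Set.Icc (M - 1) M).indicator (fun t => 2 * c ^ 2 * ‖u t‖ ^ 2) t := by
    intro t
    have i1 : (Set.Icc s (s + 1)).indicator (fun t => 2 * c ^ 2 * ‖u t‖ ^ 2) t
        = 2 * (c * (Set.Icc (0:ℝ) 1).indicator 1 (t - s)) ^ 2 * ‖u t‖ ^ 2 := by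
      by_cases h : t ∈ Set.Icc s (s + 1)
      · rw [Set.indicator_of_mem h, Set.indicator_of_mem
          (show t - s ∈ Set.Icc (0:ℝ) 1 from ⟨by linarith [h.1], by linarith [h.2]⟩)]
        simp
      · rw [Set.indicator_of_notMem h, Set.indicator_of_notMem
          (fun h' => h ⟨by linarith [h'.1], by linarith [h'.2]⟩)]
        simp
    have i2 : (Set.Icc (M - 1) M).indicator (fun t => 2 * c ^ 2 * ‖u t‖ ^ 2) t
        = 2 * (c * (Set.Icc (0:ℝ) 1).indicator 1 (M - t)) ^ 2 * ‖u t‖ ^ 2 := by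
      by_cases h : t ∈ Set.Icc (M - 1) M
      · rw [Set.indicator_of_mem h, Set.indicator_of_mem
          (show M - t ∈ Set.Icc (0:ℝ) 1 from ⟨by linarith [h.2], by linarith [h.1]⟩)]
        simp
      · rw [Set.indicator_of_notMem h, Set.indicator_of_notMem
          (fun h' => h ⟨by linarith [h'.2], by linarith [h'.1]⟩)]
        simp
    rw [i1, i2, ← add_mul]
    refine mul_le_mul_of_nonneg_right ?_ (by positivity)
    have h1 : |deriv p (t - s) * p (M - t)| ≤ c * (Set.Icc (0:ℝ) 1).indicator 1 (t - s) := by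
      rw [abs_mul]
      exact (mul_le_of_le_one_right (abs_nonneg _) (hp01 _)).trans (hc _)
    have h2 : |p (t - s) * deriv p (M - t)| ≤ c * (Set.Icc (0:ℝ) 1).indicator 1 (M - t) := by
      rw [abs_mul]
      exact (mul_le_of_le_one_left (abs_nonneg _) (hp01 _)).trans (hc _)
    have h3 := sq_norm_add_le (deriv p (t - s) * p (M - t)) (-(p (t - s) * deriv p (M - t)))
    rw [norm_neg, Real.norm_eq_abs, Real.norm_eq_abs, Real.norm_eq_abs, sq_abs, ← sub_eq_add_neg]
      at h3
    refine h3.trans ?_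
    gcongr
  set w : ℝ → E := fun t => χ t • B t (u t) + χ' t • u t with hw
  have hwc : Continuous w := by fun_prop
  have hprim : IsPrimitive (fun t => χ t • u t) w :=
    IsPrimitive.of_hasDerivAt (fun t => (hχd t).smul (hu t)) hwc
  have hm1 : MemLp (fun t => χ t • u t) 2 volume :=
    (hχc.smul huc).memLp_of_hasCompactSupport
      (HasCompactSupport.intro (K := Set.Icc s M) isCompact_Icc fun t ht => by simp [hχ0 t ht])
  have hm2 : MemLp w 2 volume := hwc.memLp_of_hasCompactSupport
    (HasCompactSupport.intro (K := Set.Icc s M) isCompact_Icc fun t ht => by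
      simp [hw, hχ0 t ht, hχ'0 t ht])
  have hmain := hB' _ _ hprim hm1 hm2
  have hχu2 : Integrable (fun t => ‖χ t • u t‖ ^ 2) volume :=
    (memLp_two_iff_integrable_sq_norm hm1.1).1 hm1
  have hgc : Continuous fun t => 2 * c ^ 2 * ‖u t‖ ^ 2 := by fun_prop
  have hg1 : Integrable ((Set.Icc s (s + 1)).indicator fun t => 2 * c ^ 2 * ‖u t‖ ^ 2) volume :=
    (hgc.integrableOn_Icc).integrable_indicator measurableSet_Icc
  have hg2 : Integrable ((Set.Icc (M - 1) M).indicator fun t => 2 * c ^ 2 * ‖u t‖ ^ 2) volume :=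
    (hgc.integrableOn_Icc).integrable_indicator measurableSet_Icc
  have hg12 : Integrable (fun t =>
      (Set.Icc s (s + 1)).indicator (fun t => 2 * c ^ 2 * ‖u t‖ ^ 2) t +
        (Set.Icc (M - 1) M).indicator (fun t => 2 * c ^ 2 * ‖u t‖ ^ 2) t) volume := hg1.add hg2
  have hle : ∫ t, ‖w t - B' t (χ t • u t)‖ ^ 2 ≤
      ∫ t, (2 * ε ^ 2 * ‖χ t • u t‖ ^ 2 +
        2 * ((Set.Icc s (s + 1)).indicator (fun t => 2 * c ^ 2 * ‖u t‖ ^ 2) t +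
          (Set.Icc (M - 1) M).indicator (fun t => 2 * c ^ 2 * ‖u t‖ ^ 2) t)) := by
    refine integral_mono_of_nonneg (Eventually.of_forall fun t => by positivity)
      ((hχu2.const_mul _).add (hg12.const_mul 2)) (Eventually.of_forall fun t => ?_)
    have e : w t - B' t (χ t • u t) = (B t - B' t) (χ t • u t) + χ' t • u t := by
      simp only [hw, sub_apply, map_smul, smul_sub]; abel
    have h1 : ‖(B t - B' t) (χ t • u t)‖ ^ 2 ≤ ε ^ 2 * ‖χ t • u t‖ ^ 2 := by
      by_cases ht : t ∈ Set.Icc s M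
      · rw [← mul_pow]
        gcongr
        exact (B t - B' t).le_of_opNorm_le (hb t (hs.trans ht.1)) _
      · simp [hχ0 t ht]
    have h2 := sq_norm_add_le ((B t - B' t) (χ t • u t)) (χ' t • u t)
    have h3 : ‖χ' t • u t‖ ^ 2 = χ' t ^ 2 * ‖u t‖ ^ 2 := by
      rw [norm_smul, mul_pow, Real.norm_eq_abs, sq_abs]
    have h4 := hχ'sq t
    simp only [e]
    linarith
  rw [integral_add (hχu2.const_mul _) (hg12.const_mul 2), integral_const_mul,
    integral_const_mul, integral_add hg1 hg2, integral_indicator measurableSet_Icc,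
    integral_indicator measurableSet_Icc, integral_Icc_eq_integral_Ioc, integral_Icc_eq_integral_Ioc,
    ← intervalIntegral.integral_of_le (by linarith), ← intervalIntegral.integral_of_le (by linarith),
    intervalIntegral.integral_const_mul, intervalIntegral.integral_const_mul] at hle
  have hlow : ∫ t in (s + 1)..(M - 1), ‖u t‖ ^ 2 ≤ ∫ t, ‖χ t • u t‖ ^ 2 := by
    rw [intervalIntegral.integral_of_le (by linarith)]
    have : ∫ t in Set.Ioc (s + 1) (M - 1), ‖u t‖ ^ 2
        = ∫ t in Set.Ioc (s + 1) (M - 1), ‖χ t • u t‖ ^ 2 := by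
      refine setIntegral_congr_fun measurableSet_Ioc fun t ht => ?_
      have h1 : p (t - s) = 1 := Real.smoothTransition.one_of_one_le (by linarith [ht.1])
      have h2 : p (M - t) = 1 := Real.smoothTransition.one_of_one_le (by linarith [ht.2])
      simp [hχ, h1, h2]
    rw [this]
    exact setIntegral_le_integral hχu2 (Eventually.of_forall fun t => by positivity)
  have hi1 : 0 ≤ ∫ t in s..(s + 1), ‖u t‖ ^ 2 :=
    intervalIntegral.integral_nonneg (by linarith) fun t _ => by positivity
  have hi2 : 0 ≤ ∫ t in (M - 1)..M, ‖u t‖ ^ 2 :=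
    intervalIntegral.integral_nonneg (by linarith) fun t _ => by positivity
  have hY : 0 ≤ ∫ t, ‖χ t • u t‖ ^ 2 := integral_nonneg fun t => by positivity
  set Y := ∫ t, ‖χ t • u t‖ ^ 2
  set i := ∫ t in s..(s + 1), ‖u t‖ ^ 2
  set j := ∫ t in (M - 1)..M, ‖u t‖ ^ 2
  have h5 := hmain.trans (mul_le_mul_of_nonneg_left hle hC)
  have h6 := mul_le_mul_of_nonneg_right hε hY
  have : Y ≤ 8 * C * c ^ 2 * (i + j) := by linarith
  linarith

/-- Exponential decay at `+∞` of the solutions of an asymptotically controlled system that tend to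
zero. -/
theorem exists_exp_decay_atTop [CompleteSpace E] {B B' : ℝ → E →L[ℝ] E} (hB : Continuous B) {K : ℝ}
    (hK : ∀ t, ‖B t‖ ≤ K) {C : ℝ} (hC : 0 ≤ C) (hB' : HasL2Bound B' C)
    (hlim : Tendsto (fun t => B t - B' t) atTop (𝓝 0)) {u : ℝ → E}
    (hu : ∀ t, HasDerivAt u (B t (u t)) t) (hu0 : Tendsto u atTop (𝓝 0)) :
    ∃ D γ : ℝ, 0 ≤ D ∧ 0 < γ ∧ ∀ t, 0 ≤ t → ‖u t‖ ≤ D * Real.exp (-γ * t) := by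
  have huc : Continuous u := continuous_iff_continuousAt.2 fun t => (hu t).continuousAt
  have hgc : Continuous fun t => ‖u t‖ ^ 2 := by fun_prop
  have hgi : ∀ a b, IntervalIntegrable (fun t => ‖u t‖ ^ 2) volume a b := fun a b =>
    hgc.intervalIntegrable a b
  obtain ⟨R, κ, hκ, hRκ⟩ := exists_integral_le_boundary hB hC hB' hlim
  obtain ⟨R', hR'⟩ := eventually_atTop.1 (hu0.norm.eventually_le_const
    (show ‖(0:E)‖ < 1 by simp))
  set s₀ : ℝ := max (max R R') 0 with hs₀
  -- Square integrability is a conclusion here: beyond s₀ one has ‖u‖ ≤ 1, so the right-end mass is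
  -- at most 1 for every M and the mass in the middle stays bounded.
  have hint : IntegrableOn (fun t => ‖u t‖ ^ 2) (Set.Ioi s₀) volume := by
    refine integrableOn_Ioi_of_intervalIntegral_norm_bounded
      ((∫ t in s₀..(s₀ + 1), ‖u t‖ ^ 2) + κ * ((∫ t in s₀..(s₀ + 1), ‖u t‖ ^ 2) + 1)) s₀
      (l := atTop) (b := fun M => M - 1) (fun M => hgc.integrableOn_Ioc)
      (tendsto_atTop_add_const_right _ _ tendsto_id) ?_
    filter_upwards [eventually_ge_atTop (s₀ + 2)] with M hM
    have h1 := hRκ u hu s₀ M ((le_max_left _ _).trans (le_max_left _ _)) hM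
    have h2 : ∫ t in (M - 1)..M, ‖u t‖ ^ 2 ≤ 1 := by
      have := intervalIntegral.integral_mono_on (a := M - 1) (b := M) (by linarith)
        (hgi _ _) (g := fun _ => (1:ℝ)) (by simp) fun t ht => by
          have h := hR' t (((le_max_right _ _).trans (le_max_left _ _)).trans
            (show s₀ ≤ t by linarith [ht.1]))
          exact pow_le_one₀ (norm_nonneg _) h
      simpa using this
    have h3 := intervalIntegral.integral_add_adjacent_intervals (hgi s₀ (s₀ + 1))
      (hgi (s₀ + 1) (M - 1))
    have e : (fun t => ‖‖u t‖ ^ 2‖) = fun t => ‖u t‖ ^ 2 := by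
      funext t; rw [Real.norm_of_nonneg (by positivity)]
    rw [e, ← h3]
    have := mul_le_mul_of_nonneg_left h2 hκ.le
    linarith
  set T : ℝ → ℝ := fun s => ∫ t in Set.Ioi s, ‖u t‖ ^ 2 with hT
  have hints : ∀ s, s₀ ≤ s → IntegrableOn (fun t => ‖u t‖ ^ 2) (Set.Ioi s) volume := fun s hs =>
    hint.mono_set (Set.Ioi_subset_Ioi hs)
  have hT0 : ∀ s, 0 ≤ T s := fun s => integral_nonneg fun t => by positivity
  have hTsub : ∀ s r, s₀ ≤ s → s ≤ r → T s - T r = ∫ t in s..r, ‖u t‖ ^ 2 := fun s r hs hr =>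
    intervalIntegral.integral_Ioi_sub_Ioi (hints s hs) hr
  have hTanti : ∀ s r, s₀ ≤ s → s ≤ r → T r ≤ T s := fun s r hs hr => by
    have h1 := hTsub s r hs hr
    have h2 := intervalIntegral.integral_nonneg (μ := volume) hr
      fun t _ => (by positivity : 0 ≤ ‖u t‖ ^ 2)
    linarith
  -- Let M → ∞: now that the tail is integrable, the right-end mass tends to zero.
  have hstep : ∀ s, s₀ ≤ s → T (s + 1) ≤ κ * (T s - T (s + 1)) := by
    intro s hs
    have hlimM : Tendsto (fun M => ∫ t in (s + 1)..M, ‖u t‖ ^ 2) atTop (𝓝 (T (s + 1))) :=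
      intervalIntegral_tendsto_integral_Ioi _ (hints _ (by linarith)) tendsto_id
    have hshift : Tendsto (fun M : ℝ => M - 1) atTop atTop :=
      tendsto_atTop_add_const_right _ _ tendsto_id
    have hlim1 := hlimM.comp hshift
    have hlim2 : Tendsto (fun M => ∫ t in (M - 1)..M, ‖u t‖ ^ 2) atTop (𝓝 0) := by
      have := hlimM.sub hlim1
      rw [sub_self] at this
      refine this.congr fun M => ?_
      exact intervalIntegral.integral_interval_sub_left (hgi _ _) (hgi _ _)
    rw [hTsub s (s + 1) hs (by linarith)]
    have hr := (tendsto_const_nhds (x := ∫ t in s..(s + 1), ‖u t‖ ^ 2)).add hlim2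
    rw [add_zero] at hr
    refine le_of_tendsto_of_tendsto hlim1 (hr.const_mul κ) ?_
    filter_upwards [eventually_ge_atTop (s + 2)] with M hM
    exact hRκ u hu s M (((le_max_left _ _).trans (le_max_left _ _)).trans hs) hM
  -- Solving the last inequality for T (s + 1) gives the contraction factor q < 1.
  set q : ℝ := κ / (1 + κ) with hq
  have hq0 : 0 < q := by positivity
  have hq1 : q < 1 := by rw [hq, div_lt_one (by positivity)]; linarith
  have hgeo : ∀ n : ℕ, T (s₀ + n) ≤ q ^ n * T s₀ := by
    intro n
    induction n with
    | zero => simp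
    | succ n ih =>
      have h := hstep (s₀ + n) (by linarith [n.cast_nonneg (α := ℝ)])
      have h1 : T (s₀ + n + 1) ≤ q * T (s₀ + n) := by
        rw [hq, div_mul_eq_mul_div, le_div_iff₀ (by positivity)]
        linarith
      rw [show s₀ + ((n + 1 : ℕ) : ℝ) = s₀ + n + 1 by push_cast; ring, pow_succ]
      calc _ ≤ q * T (s₀ + n) := h1
        _ ≤ q * (q ^ n * T s₀) := by gcongr
        _ = _ := by ring
  have hprim : IsPrimitive u (fun t => B t (u t)) := IsPrimitive.of_hasDerivAt hu (by fun_prop)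
  -- From mass to pointwise values: the Sobolev inequality on [t, t + 1], with u' = Bu bounded by
  -- K‖u‖.
  have hptw : ∀ t, s₀ ≤ t → ‖u t‖ ^ 2 ≤ (2 + 2 * K ^ 2) * T t := by
    intro t ht
    have hv : Continuous fun r => ‖B r (u r)‖ ^ 2 := by fun_prop
    have h1 := hprim.sq_norm_le zero_le_one (a := t) (s := t) (hv.intervalIntegrable _ _)
      ⟨le_rfl, by linarith⟩
    have h2 : ∫ r in t..t + 1, ‖B r (u r)‖ ^ 2 ≤ K ^ 2 * ∫ r in t..t + 1, ‖u r‖ ^ 2 := by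
      rw [← intervalIntegral.integral_const_mul]
      refine intervalIntegral.integral_mono_on (by linarith) (hv.intervalIntegrable _ _)
        ((hgi _ _).const_mul _) fun r _ => ?_
      rw [← mul_pow]
      gcongr
      exact (B r).le_of_opNorm_le (hK r) _
    have h3 := hTsub t (t + 1) ht (by linarith)
    have h4 : (2 + 2 * K ^ 2) * (∫ r in t..t + 1, ‖u r‖ ^ 2) ≤ (2 + 2 * K ^ 2) * T t := by
      have := hT0 (t + 1)
      gcongr
      linarith
    linarith
  set L : ℝ := -Real.log q with hL
  have hL0 : 0 < L := by have := Real.log_neg hq0 hq1; linarith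
  -- The 1 in s₀ + 1 pays for rounding t - s₀ down to an integer.
  have hTexp : ∀ t, s₀ ≤ t → T t ≤ T s₀ * Real.exp (L * (s₀ + 1)) * Real.exp (-L * t) := by
    intro t ht
    set n := ⌊t - s₀⌋₊ with hn
    have hn1 : (n : ℝ) ≤ t - s₀ := Nat.floor_le (by linarith)
    have hn2 : t - s₀ < n + 1 := Nat.lt_floor_add_one _
    have h1 := (hTanti (s₀ + n) t (by linarith [n.cast_nonneg (α := ℝ)]) (by linarith)).trans
      (hgeo n)
    have h2 : q ^ n ≤ Real.exp (L * (s₀ + 1)) * Real.exp (-L * t) := by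
      rw [← Real.exp_add, ← Real.exp_log (pow_pos hq0 n), Real.log_pow]
      refine Real.exp_le_exp.2 ?_
      rw [show Real.log q = -L by rw [hL]; ring]
      nlinarith
    calc T t ≤ q ^ n * T s₀ := h1
      _ ≤ (Real.exp (L * (s₀ + 1)) * Real.exp (-L * t)) * T s₀ := by
        gcongr
      _ = _ := by ring
  obtain ⟨M₀, hM₀⟩ := isCompact_Icc.exists_bound_of_continuousOn (s := Set.Icc 0 s₀) huc.continuousOn
  -- D₁ serves t ≥ s₀, where taking a square root halves the rate to L/2; D₂ serves the compact
  -- interval [0, s₀].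
  set D₁ : ℝ := Real.sqrt ((2 + 2 * K ^ 2) * (T s₀ * Real.exp (L * (s₀ + 1)))) with hD₁
  set D₂ : ℝ := max M₀ 0 * Real.exp (L / 2 * s₀) with hD₂
  have hD₂0 : 0 ≤ D₂ := mul_nonneg (le_max_right _ _) (Real.exp_pos _).le
  refine ⟨D₁ + D₂, L / 2, by positivity, by positivity, fun t ht => ?_⟩
  rw [add_mul]
  rcases le_total s₀ t with h | h
  · have h1 := (hptw t h).trans (mul_le_mul_of_nonneg_left (hTexp t h) (by positivity))
    have h2 : ‖u t‖ ≤ D₁ * Real.exp (-(L / 2) * t) := by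
      refine le_of_sq_le_sq ?_ (by positivity)
      rw [mul_pow, hD₁, Real.sq_sqrt (mul_nonneg (by positivity)
        (mul_nonneg (hT0 _) (Real.exp_pos _).le)), ← Real.exp_nat_mul]
      rw [show ((2:ℕ):ℝ) * (-(L / 2) * t) = -L * t by push_cast; ring]
      linarith
    have h3 : 0 ≤ D₂ * Real.exp (-(L / 2) * t) := mul_nonneg hD₂0 (Real.exp_pos _).le
    linarith
  · have h1 := hM₀ t ⟨ht, h⟩
    have h2 : max M₀ 0 ≤ D₂ * Real.exp (-(L / 2) * t) := by
      rw [hD₂, mul_assoc, ← Real.exp_add]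
      refine le_mul_of_one_le_right (le_max_right _ _) (Real.one_le_exp ?_)
      nlinarith
    have h3 : 0 ≤ D₁ * Real.exp (-(L / 2) * t) := by positivity
    have := le_max_left M₀ 0
    linarith

/-- Exponential decay of homoclinic solutions of an asymptotically controlled system. -/
theorem exists_exp_decay [CompleteSpace E] {B Bp Bm : ℝ → E →L[ℝ] E} (hB : Continuous B) {K : ℝ}
    (hK : ∀ t, ‖B t‖ ≤ K) {Cp Cm : ℝ} (hCp : 0 ≤ Cp) (hCm : 0 ≤ Cm) (hBp : HasL2Bound Bp Cp)
    (hBm : HasL2Bound Bm Cm) (hp : Tendsto (fun t => B t - Bp t) atTop (𝓝 0))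
    (hm : Tendsto (fun t => B t - Bm t) atBot (𝓝 0)) {u : ℝ → E}
    (hu : ∀ t, HasDerivAt u (B t (u t)) t) (hutop : Tendsto u atTop (𝓝 0))
    (hubot : Tendsto u atBot (𝓝 0)) :
    ∃ D γ : ℝ, 0 < γ ∧ ∀ t, ‖u t‖ ≤ D * Real.exp (-γ * |t|) := by
  obtain ⟨D₁, γ₁, hD₁, hγ₁, h₁⟩ := exists_exp_decay_atTop hB hK hCp hBp hp hu hutop
  obtain ⟨D₂, γ₂, hD₂, hγ₂, h₂⟩ := exists_exp_decay_atTop (B := fun t => -B (-t))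
    (B' := fun t => -Bm (-t)) (u := fun t => u (-t)) (by fun_prop) (K := K)
    (fun t => by rw [norm_neg]; exact hK _) hCm hBm.comp_neg (by
      have := (hm.comp tendsto_neg_atTop_atBot).neg
      rw [neg_zero] at this
      refine this.congr fun t => ?_
      simp only [Function.comp]
      abel) (fun t => by
        have := (hu (-t)).scomp t (hasDerivAt_neg t)
        rw [neg_one_smul] at this
        exact this)
    (hubot.comp tendsto_neg_atTop_atBot)
  have hle : ∀ {D D' γ γ' r : ℝ}, 0 ≤ D → 0 ≤ r → D ≤ D' → γ' ≤ γ →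
      D * Real.exp (-γ * r) ≤ D' * Real.exp (-γ' * r) := by
    intro D D' γ γ' r hD hr h1 h2
    have : -γ * r ≤ -γ' * r := by nlinarith
    gcongr
    exact hD.trans h1
  refine ⟨max D₁ D₂, min γ₁ γ₂, lt_min hγ₁ hγ₂, fun t => ?_⟩
  rcases le_total 0 t with ht | ht
  · rw [abs_of_nonneg ht]
    exact (h₁ t ht).trans (hle hD₁ ht (le_max_left _ _) (min_le_left _ _))
  · rw [abs_of_nonpos ht]
    have := h₂ (-t) (by linarith)
    rw [neg_neg] at this
    exact this.trans (hle hD₂ (by linarith) (le_max_right _ _) (min_le_right _ _))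

end Decay

/-! ### Integration by parts and the du Bois-Reymond lemma -/

section IntegrationByParts

variable {E : Type*} [NormedAddCommGroup E] [InnerProductSpace ℝ E]

theorem tendsto_integral_unit_interval {g : ℝ → ℝ} (hg : Integrable g volume) :
    Tendsto (fun t => ∫ s in t..t + 1, g s) atTop (𝓝 0) := by
  have h1 : Tendsto (fun t => ∫ s in (0:ℝ)..t, g s) atTop (𝓝 (∫ s in Set.Ioi 0, g s)) :=
    intervalIntegral_tendsto_integral_Ioi _ hg.integrableOn tendsto_id
  have h2 := (h1.comp (tendsto_atTop_add_const_right atTop (1:ℝ) tendsto_id)).sub h1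
  rw [sub_self] at h2
  refine h2.congr fun t => ?_
  exact intervalIntegral.integral_interval_sub_left hg.intervalIntegrable hg.intervalIntegrable

/-- The Sobolev inequality on [t, t + 1] bounds ‖u t‖² by integrals over a moving unit interval,
which tend to zero. -/
theorem IsPrimitive.tendsto_atTop {u v : ℝ → E} (h : IsPrimitive u v) (hu : MemLp u 2 volume)
    (hv : MemLp v 2 volume) : Tendsto u atTop (𝓝 0) := by
  have hu2 : Integrable (fun t => ‖u t‖ ^ 2) volume := (memLp_two_iff_integrable_sq_norm hu.1).1 hu
  have hv2 : Integrable (fun t => ‖v t‖ ^ 2) volume := (memLp_two_iff_integrable_sq_norm hv.1).1 hv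
  have hlim := ((tendsto_integral_unit_interval hu2).const_mul 2).add
    ((tendsto_integral_unit_interval hv2).const_mul 2)
  simp only [mul_zero, add_zero] at hlim
  have hsq : Tendsto (fun t => ‖u t‖ ^ 2) atTop (𝓝 0) :=
    squeeze_zero (fun t => by positivity) (fun t => by
      have := h.sq_norm_le zero_le_one (a := t) hv2.intervalIntegrable (s := t)
        ⟨le_rfl, by linarith⟩
      simpa using this) hlim
  have := hsq.sqrt
  simp only [Real.sqrt_zero, Real.sqrt_sq (norm_nonneg _)] at this
  exact tendsto_zero_iff_norm_tendsto_zero.2 this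

theorem IsPrimitive.tendsto_atBot {u v : ℝ → E} (h : IsPrimitive u v) (hu : MemLp u 2 volume)
    (hv : MemLp v 2 volume) : Tendsto u atBot (𝓝 0) := by
  have hm := Measure.measurePreserving_neg (volume : Measure ℝ)
  have := (h.comp_neg.tendsto_atTop (hu.comp_measurePreserving hm)
    (hv.comp_measurePreserving hm).neg).comp tendsto_neg_atBot_atTop
  simpa [Function.comp_def] using this

theorem integrable_inner_of_memLp {u v : ℝ → E} (hu : MemLp u 2 volume) (hv : MemLp v 2 volume) :
    Integrable (fun t => inner ℝ (u t) (v t)) volume := by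
  refine (L2.integrable_inner (𝕜 := ℝ) hu.toLp hv.toLp).congr ?_
  filter_upwards [hu.coeFn_toLp, hv.coeFn_toLp] with t h1 h2
  rw [h1, h2]

variable [FiniteDimensional ℝ E]

/-- Coordinates in an orthonormal basis reduce this to the product rule for scalar functions. -/
theorem IsPrimitive.integral_inner_add_inner {u v y z : ℝ → E} (h : IsPrimitive u v)
    (h' : IsPrimitive y z) (a b : ℝ) :
    ∫ t in a..b, (inner ℝ (v t) (y t) + inner ℝ (u t) (z t))
      = inner ℝ (u b) (y b) - inner ℝ (u a) (y a) := by
  have : CompleteSpace E := FiniteDimensional.complete ℝ E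
  set e := stdOrthonormalBasis ℝ E with he
  have hs : ∀ i, IsPrimitive (fun t => inner ℝ (e i) (u t)) (fun t => inner ℝ (e i) (v t)) :=
    fun i => h.clm_comp (innerSL ℝ (e i))
  have hs' : ∀ i, IsPrimitive (fun t => inner ℝ (e i) (y t)) (fun t => inner ℝ (e i) (z t)) :=
    fun i => h'.clm_comp (innerSL ℝ (e i))
  have hin : ∀ p q : E, inner ℝ p q = ∑ i, inner ℝ (e i) p * inner ℝ (e i) q := by
    intro p q
    rw [← e.sum_inner_mul_inner p q]
    exact Finset.sum_congr rfl fun i _ => by rw [real_inner_comm]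
  have hint : ∀ i, IntervalIntegrable (fun t => inner ℝ (e i) (v t) * inner ℝ (e i) (y t) +
      inner ℝ (e i) (u t) * inner ℝ (e i) (z t)) volume a b := fun i =>
    (((hs i).intervalIntegrable a b).mul_continuousOn (hs' i).continuous.continuousOn).add
      (((hs' i).intervalIntegrable a b).continuousOn_mul (hs i).continuous.continuousOn)
  have hpt : (fun t => inner ℝ (v t) (y t) + inner ℝ (u t) (z t))
      = fun t => ∑ i, (inner ℝ (e i) (v t) * inner ℝ (e i) (y t) +
        inner ℝ (e i) (u t) * inner ℝ (e i) (z t)) := by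
    funext t
    rw [hin (v t), hin (u t), Finset.sum_add_distrib]
  rw [hpt, hin (u b), hin (u a), ← Finset.sum_sub_distrib]
  rw [intervalIntegral.integral_finsetSum fun i _ => hint i]
  exact Finset.sum_congr rfl fun i _ => (hs i).integral_mul_add_mul (hs' i) a b

/-- Integration by parts on the whole line for functions in `H¹`. -/
theorem IsPrimitive.integral_inner_add_inner_eq_zero {u v y z : ℝ → E} (h : IsPrimitive u v)
    (h' : IsPrimitive y z) (hu : MemLp u 2 volume) (hv : MemLp v 2 volume) (hy : MemLp y 2 volume)
    (hz : MemLp z 2 volume) :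
    ∫ t, (inner ℝ (v t) (y t) + inner ℝ (u t) (z t)) = 0 := by
  have hint : Integrable (fun t => inner ℝ (v t) (y t) + inner ℝ (u t) (z t)) volume :=
    (integrable_inner_of_memLp hv hy).add (integrable_inner_of_memLp hu hz)
  have h1 := intervalIntegral_tendsto_integral hint tendsto_neg_atTop_atBot tendsto_id
  simp only [h.integral_inner_add_inner h'] at h1
  have h2 := (Tendsto.inner (𝕜 := ℝ) (h.tendsto_atTop hu hv) (h'.tendsto_atTop hy hz)).sub
    ((Tendsto.inner (𝕜 := ℝ) (h.tendsto_atBot hu hv) (h'.tendsto_atBot hy hz)).comp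
      tendsto_neg_atTop_atBot)
  rw [inner_zero_left, sub_zero] at h2
  exact tendsto_nhds_unique h1 h2

/-- Pairing with a fixed vector e turns this into integration by parts of φe against u on an
interval containing the support of φ, where the boundary terms vanish. -/
theorem IsPrimitive.integral_deriv_smul {u v : ℝ → E} (h : IsPrimitive u v) {φ : ℝ → ℝ}
    (hφ : ContDiff ℝ 1 φ) (hc : HasCompactSupport φ) :
    ∫ t, deriv φ t • u t = -∫ t, φ t • v t := by
  have : CompleteSpace E := FiniteDimensional.complete ℝ E
  have hi1 : Integrable (fun t => deriv φ t • u t) volume :=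
    h.continuous.locallyIntegrable.integrable_smul_left_of_hasCompactSupport
      (hφ.continuous_deriv le_rfl) hc.deriv
  have hi2 : Integrable (fun t => φ t • v t) volume :=
    LocallyIntegrable.integrable_smul_left_of_hasCompactSupport h.locallyIntegrable
      hφ.continuous hc
  rw [eq_neg_iff_add_eq_zero, ← integral_add hi1 hi2]
  refine ext_inner_left ℝ fun e => ?_
  rw [inner_zero_right, ← integral_inner (show Integrable (fun t => deriv φ t • u t + φ t • v t) volume from hi1.add hi2)]
  have hφe : IsPrimitive (fun t => φ t • e) (fun t => deriv φ t • e) :=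
    IsPrimitive.of_hasDerivAt
      (fun t => ((hφ.differentiable one_ne_zero t).hasDerivAt).smul_const e)
      ((hφ.continuous_deriv le_rfl).smul continuous_const)
  obtain ⟨R, hR⟩ := hc.isCompact.isBounded.subset_ball 0
  have hsupp : ∀ t, t ∉ Set.Ioc (-R) R → t ∉ tsupport φ := by
    intro t ht h'
    have := hR h'
    rw [Real.ball_eq_Ioo] at this
    exact ht ⟨by linarith [this.1], by linarith [this.2]⟩
  have hz : ∀ t, t ∉ tsupport φ → φ t = 0 := fun t ht => image_eq_zero_of_notMem_tsupport ht
  have hz' : ∀ t, t ∉ tsupport φ → deriv φ t = 0 := fun t ht =>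
    image_eq_zero_of_notMem_tsupport fun h' => ht (tsupport_deriv_subset h')
  have hbd : ∀ t, ‖t‖ = ‖R‖ → φ t = 0 := by
    intro t ht
    refine hz t fun h' => ?_
    have := hR h'
    rw [mem_ball_zero_iff, ht] at this
    exact absurd this (not_lt.2 (le_abs_self R))
  have key := hφe.integral_inner_add_inner h (-R) R
  simp only [hbd R rfl, hbd (-R) (norm_neg R), zero_smul, inner_zero_left, sub_zero] at key
  rw [intervalIntegral.integral_eq_integral_of_support_subset] at key
  · rw [← key]
    refine integral_congr_ae (Eventually.of_forall fun t => ?_)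
    simp only [inner_add_right, inner_smul_left, inner_smul_right]
    rfl
  · intro t ht
    by_contra hn
    refine ht ?_
    simp [hz t (hsupp t hn), hz' t (hsupp t hn)]

/-- The du Bois-Reymond lemma. -/
theorem exists_ae_eq_const_of_integral_deriv_smul {w : ℝ → E} (hw : LocallyIntegrable w volume)
    (h : ∀ φ : ℝ → ℝ, ContDiff ℝ ∞ φ → HasCompactSupport φ → ∫ t, deriv φ t • w t = 0) :
    ∃ c : E, w =ᵐ[volume] fun _ => c := by
  have : CompleteSpace E := FiniteDimensional.complete ℝ E
  let β : ContDiffBump (0:ℝ) := default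
  set ψ : ℝ → ℝ := β.normed volume with hψ
  have hψs : ContDiff ℝ ∞ ψ := β.contDiff_normed
  have hψc : HasCompactSupport ψ := β.hasCompactSupport_normed
  have hψ1 : ∫ t, ψ t = 1 := β.integral_normed
  refine ⟨∫ t, ψ t • w t, ?_⟩
  refine ae_eq_of_integral_contDiff_smul_eq hw continuous_const.locallyIntegrable fun g hg hgc => ?_
  rw [integral_smul_const]
  set a : ℝ := ∫ t, g t with ha
  -- Subtracting a multiple of the unit-mass bump gives q mean zero, so its primitive Q has compact
  -- support and is an admissible test function with Q' = q.
  set q : ℝ → ℝ := fun t => g t - a * ψ t with hq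
  have hqs : ContDiff ℝ ∞ q := hg.sub (contDiff_const.mul hψs)
  have hqc : HasCompactSupport q := hgc.sub hψc.mul_left
  have hq0 : ∫ t, q t = 0 := by
    rw [hq, integral_sub (hg.continuous.integrable_of_hasCompactSupport hgc)
      ((hψs.continuous.integrable_of_hasCompactSupport hψc).const_mul a), integral_const_mul, hψ1]
    simp [ha]
  obtain ⟨R, hR⟩ := hqc.isCompact.isBounded.subset_ball 0
  have hqz : ∀ t, t ∉ Set.Ioo (-R) R → q t = 0 := by
    intro t ht
    refine image_eq_zero_of_notMem_tsupport fun h' => ht ?_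
    have := hR h'
    rw [Real.ball_eq_Ioo] at this
    simpa using this
  set Q : ℝ → ℝ := fun t => ∫ s in (-R)..t, q s with hQ
  have hQd : ∀ t, HasDerivAt Q (q t) t := fun t =>
    intervalIntegral.integral_hasDerivAt_right (hqs.continuous.intervalIntegrable _ _)
      hqs.continuous.stronglyMeasurable.stronglyMeasurableAtFilter hqs.continuous.continuousAt
  have hQ' : deriv Q = q := funext fun t => (hQd t).deriv
  have hQs : ContDiff ℝ ∞ Q := by
    rw [contDiff_infty_iff_deriv, hQ']
    exact ⟨fun t => (hQd t).differentiableAt, hqs⟩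
  have hQc : HasCompactSupport Q := by
    refine HasCompactSupport.intro (K := Set.Icc (-R) R) isCompact_Icc fun t ht => ?_
    rcases lt_or_ge t (-R) with h1 | h1
    · simp only [hQ]
      refine intervalIntegral.integral_zero_ae (Eventually.of_forall fun s hs => hqz s fun h' => ?_)
      rw [Set.uIoc_of_ge h1.le] at hs
      linarith [h'.1, hs.2]
    · have h2 : R < t := by
        by_contra h2
        exact ht ⟨h1, not_lt.1 h2⟩
      simp only [hQ]
      rw [intervalIntegral.integral_eq_integral_of_support_subset, hq0]
      intro s hs
      by_contra hn
      refine hs (hqz s fun h' => hn ⟨h'.1, ?_⟩)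
      linarith [h'.2]
  have hfin := h Q hQs hQc
  rw [hQ'] at hfin
  have hi1 : Integrable (fun t => g t • w t) volume :=
    hw.integrable_smul_left_of_hasCompactSupport hg.continuous hgc
  have hi2 : Integrable (fun t => ψ t • w t) volume :=
    hw.integrable_smul_left_of_hasCompactSupport hψs.continuous hψc
  have e : ∫ t, q t • w t = (∫ t, g t • w t) - a • ∫ t, ψ t • w t := by
    rw [← integral_smul, ← integral_sub hi1
      (show Integrable (fun t => a • ψ t • w t) volume from hi2.smul a)]
    refine integral_congr_ae (Eventually.of_forall fun t => ?_)
    simp only [hq, sub_smul, mul_smul]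
  rw [e, sub_eq_zero] at hfin
  exact hfin

end IntegrationByParts

/-! ### The space H¹: continuous representatives, embedding, completeness -/

section Sobolev

variable {N : ℕ}

theorem L2_norm_sq (f : L2 N) : ‖f‖ ^ 2 = ∫ t, ‖f t‖ ^ 2 := by
  rw [← real_inner_self_eq_norm_sq, L2.inner_def]
  simp only [real_inner_self_eq_norm_sq]

theorem L2_integrable_sq (f : L2 N) : Integrable (fun t => ‖f t‖ ^ 2) volume :=
  (memLp_two_iff_integrable_sq_norm (Lp.memLp f).1).1 (Lp.memLp f)

theorem L2_locallyIntegrable (f : L2 N) : LocallyIntegrable f volume :=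
  (Lp.memLp f).locallyIntegrable (by norm_num)

/-- `sobFn` as a continuous linear map. -/
noncomputable def sobFnL : H1 N →L[ℝ] L2 N := (WithLp.fstL 2 ℝ (L2 N) (L2 N)).comp (H1 N).subtypeL

/-- `sobDeriv` as a continuous linear map. -/
noncomputable def sobDerivL : H1 N →L[ℝ] L2 N :=
  (WithLp.sndL 2 ℝ (L2 N) (L2 N)).comp (H1 N).subtypeL

theorem H1_norm_sq (x : H1 N) : ‖x‖ ^ 2 = ‖sobFn x‖ ^ 2 + ‖sobDeriv x‖ ^ 2 := by
  exact WithLp.prod_norm_sq_eq_of_L2 (x : WithLp 2 (L2 N × L2 N))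

/-- Every element of `H¹` has an absolutely continuous representative. -/
theorem exists_rep (x : H1 N) :
    ∃ u : ℝ → Phase N, IsPrimitive u (sobDeriv x) ∧ u =ᵐ[volume] sobFn x := by
  have hv := L2_locallyIntegrable (sobDeriv x)
  set U : ℝ → Phase N := fun t => ∫ s in (0:ℝ)..t, sobDeriv x s with hU
  have hUp : IsPrimitive U (sobDeriv x) := IsPrimitive.of_base hv 0 fun b => by simp [hU]
  -- The difference between x and a primitive of its weak derivative has weak derivative zero, hence
  -- is a constant.
  obtain ⟨c, hc⟩ := exists_ae_eq_const_of_integral_deriv_smul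
    (w := fun t => sobFn x t - U t)
    ((L2_locallyIntegrable (sobFn x)).sub hUp.continuous.locallyIntegrable) (by
      intro φ hφ hφc
      have hd : Continuous (deriv φ) := hφ.continuous_deriv (by simp)
      have hi1 : Integrable (fun t => deriv φ t • sobFn x t) volume :=
        integrable_test_smul hd hφc.deriv _
      have hi2 : Integrable (fun t => deriv φ t • U t) volume :=
        hUp.continuous.locallyIntegrable.integrable_smul_left_of_hasCompactSupport hd hφc.deriv
      simp only [smul_sub]
      rw [integral_sub hi1 hi2, hUp.integral_deriv_smul (hφ.of_le (by simp)) hφc]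
      have hx : IsWeakDeriv (sobFn x) (sobDeriv x) := x.2
      rw [hx φ hφ hφc, sub_self])
  refine ⟨fun t => U t + c, ⟨hv, fun a b => ?_⟩, ?_⟩
  · rw [add_sub_add_right_eq_sub, hUp.sub_eq]
  · filter_upwards [hc] with t ht
    rw [← ht]; abel

/-- The continuous representative of an element of `H¹`. -/
noncomputable def rep (x : H1 N) : ℝ → Phase N := (exists_rep x).choose

theorem rep_isPrimitive (x : H1 N) : IsPrimitive (rep x) (sobDeriv x) := (exists_rep x).choose_spec.1

theorem rep_ae_eq (x : H1 N) : rep x =ᵐ[volume] sobFn x := (exists_rep x).choose_spec.2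

theorem rep_continuous (x : H1 N) : Continuous (rep x) := (rep_isPrimitive x).continuous

theorem rep_memLp (x : H1 N) : MemLp (rep x) 2 volume :=
  (memLp_congr_ae (rep_ae_eq x)).2 (Lp.memLp _)

theorem eq_rep_of_ae_eq {x : H1 N} {u : ℝ → Phase N} (hu : Continuous u)
    (h : u =ᵐ[volume] sobFn x) : u = rep x :=
  (Continuous.ae_eq_iff_eq volume hu (rep_continuous x)).1 (h.trans (rep_ae_eq x).symm)

theorem rep_add (x y : H1 N) : rep (x + y) = fun t => rep x t + rep y t := by
  refine (eq_rep_of_ae_eq ((rep_continuous x).add (rep_continuous y)) ?_).symm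
  have h : ⇑(sobFn (x + y)) =ᵐ[volume] ⇑(sobFn x) + ⇑(sobFn y) := Lp.coeFn_add _ _
  filter_upwards [h, rep_ae_eq x, rep_ae_eq y] with t h1 h2 h3
  rw [h1]
  exact congrArg₂ (· + ·) h2 h3

theorem rep_smul (c : ℝ) (x : H1 N) : rep (c • x) = fun t => c • rep x t := by
  refine (eq_rep_of_ae_eq ((rep_continuous x).const_smul c) ?_).symm
  have h : ⇑(sobFn (c • x)) =ᵐ[volume] c • ⇑(sobFn x) := Lp.coeFn_smul _ _
  filter_upwards [h, rep_ae_eq x] with t h1 h2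
  rw [h1]
  exact congrArg (c • ·) h2

/-- The Sobolev embedding `H¹ ⊂ L^∞`. -/
theorem norm_rep_le (x : H1 N) (t : ℝ) : ‖rep x t‖ ≤ Real.sqrt 2 * ‖x‖ := by
  have hv := L2_integrable_sq (sobDeriv x)
  have hu : Integrable (fun t => ‖rep x t‖ ^ 2) volume :=
    (memLp_two_iff_integrable_sq_norm (rep_memLp x).1).1 (rep_memLp x)
  have h := (rep_isPrimitive x).sq_norm_le zero_le_one (a := t) (s := t) hv.intervalIntegrable
    ⟨le_rfl, by linarith⟩
  have hle : ∀ g : ℝ → ℝ, Integrable g volume → (∀ s, 0 ≤ g s) →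
      ∫ s in t..t + 1, g s ≤ ∫ s, g s := by
    intro g hg hg0
    rw [intervalIntegral.integral_of_le (by linarith)]
    exact setIntegral_le_integral hg (Eventually.of_forall hg0)
  have h1 := hle _ hu fun s => by positivity
  have h2 := hle _ hv fun s => by positivity
  have e : ∫ s, ‖rep x s‖ ^ 2 = ∫ s, ‖sobFn x s‖ ^ 2 :=
    integral_congr_ae ((rep_ae_eq x).mono fun s hs => by simp only [hs])
  rw [e, ← L2_norm_sq] at h1
  rw [← L2_norm_sq] at h2
  refine le_of_sq_le_sq ?_ (by positivity)
  rw [mul_pow, Real.sq_sqrt (by norm_num), H1_norm_sq]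
  linarith

/-- Evaluation of the continuous representative at a point. -/
noncomputable def evalCLM (t : ℝ) : H1 N →L[ℝ] Phase N :=
  LinearMap.mkContinuous
    { toFun := fun x => rep x t
      map_add' := fun x y => by rw [rep_add]
      map_smul' := fun c x => by rw [rep_smul]; rfl } (Real.sqrt 2) fun x => norm_rep_le x t

/-- The element of `H¹` given by an absolutely continuous function in `L²` with derivative in `L²`. -/
noncomputable def ofPrimitive {u v : ℝ → Phase N} (h : IsPrimitive u v) (hu : MemLp u 2 volume)
    (hv : MemLp v 2 volume) : H1 N :=
  ⟨WithLp.toLp 2 (hu.toLp, hv.toLp), by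
    intro φ hφ hφc
    have h1 : ∫ t, deriv φ t • (hu.toLp : L2 N) t = ∫ t, deriv φ t • u t :=
      integral_congr_ae (hu.coeFn_toLp.mono fun t ht => by simp only [ht])
    have h2 : ∫ t, φ t • (hv.toLp : L2 N) t = ∫ t, φ t • v t :=
      integral_congr_ae (hv.coeFn_toLp.mono fun t ht => by simp only [ht])
    exact h1.trans ((h.integral_deriv_smul (hφ.of_le (by simp)) hφc).trans (congrArg Neg.neg h2.symm))⟩

theorem memLp_test {φ : ℝ → ℝ} (hφ : Continuous φ) (hc : HasCompactSupport φ) (e : Phase N) :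
    MemLp (fun t => φ t • e) 2 (volume : Measure ℝ) :=
  (hφ.smul continuous_const).memLp_of_hasCompactSupport hc.smul_right

theorem inner_test {φ : ℝ → ℝ} (hφ : Continuous φ) (hc : HasCompactSupport φ) (e : Phase N)
    (u : L2 N) :
    inner ℝ ((memLp_test hφ hc e).toLp : L2 N) u = inner ℝ e (∫ t, φ t • u t) := by
  rw [L2.inner_def, ← integral_inner (integrable_test_smul hφ hc u)]
  refine integral_congr_ae ?_
  filter_upwards [(memLp_test hφ hc e).coeFn_toLp] with t ht
  rw [ht, inner_smul_left, inner_smul_right]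
  rfl

/-- In this form the condition is a family of equalities between continuous functionals on L², which
makes it visibly closed and directly comparable with orthogonality relations. -/
theorem isWeakDeriv_iff (u v : L2 N) : IsWeakDeriv u v ↔
    ∀ (φ : ℝ → ℝ) (hφ : ContDiff ℝ ∞ φ) (hc : HasCompactSupport φ) (e : Phase N),
      inner ℝ ((memLp_test (hφ.continuous_deriv (by simp)) hc.deriv e).toLp : L2 N) u
        = -inner ℝ ((memLp_test hφ.continuous hc e).toLp : L2 N) v := by
  refine ⟨fun h φ hφ hc e => ?_, fun h φ hφ hc => ext_inner_left ℝ fun e => ?_⟩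
  · rw [inner_test (hφ.continuous_deriv (by simp)) hc.deriv, inner_test hφ.continuous hc, h φ hφ hc, inner_neg_right]
  · rw [inner_neg_right, ← inner_test (hφ.continuous_deriv (by simp)) hc.deriv,
      ← inner_test hφ.continuous hc, h φ hφ hc e]

theorem isClosed_H1 : IsClosed (H1 N : Set (WithLp 2 (L2 N × L2 N))) := by
  have : (H1 N : Set (WithLp 2 (L2 N × L2 N))) = {p | IsWeakDeriv p.fst p.snd} := rfl
  rw [this]
  simp only [isWeakDeriv_iff, Set.ofPred_forall]
  refine isClosed_iInter fun φ => isClosed_iInter fun hφ => isClosed_iInter fun hc =>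
    isClosed_iInter fun e => isClosed_eq ?_ ?_
  · exact continuous_const.inner (WithLp.fstL 2 ℝ (L2 N) (L2 N)).continuous
  · exact (continuous_const.inner (WithLp.sndL 2 ℝ (L2 N) (L2 N)).continuous).neg

instance completeSpace_H1 : CompleteSpace (H1 N) := isClosed_H1.completeSpace_coe

theorem isPrimitive_test {φ : ℝ → ℝ} (hφ : ContDiff ℝ 1 φ) (e : Phase N) :
    IsPrimitive (fun t => φ t • e) (fun t => deriv φ t • e) :=
  IsPrimitive.of_hasDerivAt
    (fun t => ((hφ.differentiable one_ne_zero t).hasDerivAt).smul_const e)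
    ((hφ.continuous_deriv le_rfl).smul continuous_const)

/-- Multiplication by a bounded continuous operator-valued function on `L²`. -/
noncomputable def mulL2 (A : ℝ → Phase N →L[ℝ] Phase N) (hA : Continuous A) (K : ℝ)
    (hK : ∀ t, ‖A t‖ ≤ K) : L2 N →L[ℝ] L2 N :=
  LinearMap.mkContinuous
    { toFun := fun u => (memLp_clm_apply hA hK (Lp.memLp u)).toLp
      map_add' := fun u v => by
        rw [← MemLp.toLp_add]
        refine MemLp.toLp_congr _ _ ?_
        filter_upwards [Lp.coeFn_add u v] with t ht
        rw [ht, Pi.add_apply, map_add, Pi.add_apply]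
      map_smul' := fun c u => by
        rw [RingHom.id_apply, ← MemLp.toLp_const_smul]
        refine MemLp.toLp_congr _ _ ?_
        filter_upwards [Lp.coeFn_smul c u] with t ht
        rw [ht, Pi.smul_apply, map_smul, Pi.smul_apply] } K fun u => by
    refine Lp.norm_le_mul_norm_of_ae_le_mul ?_
    filter_upwards [(memLp_clm_apply hA hK (Lp.memLp u)).coeFn_toLp] with t ht
    refine (le_of_eq (congrArg norm ht)).trans ((A t).le_of_opNorm_le (hK t) _)

theorem coeFn_mulL2 {A : ℝ → Phase N →L[ℝ] Phase N} (hA : Continuous A) {K : ℝ}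
    (hK : ∀ t, ‖A t‖ ≤ K) (u : L2 N) : mulL2 A hA K hK u =ᵐ[volume] fun t => A t (u t) :=
  (memLp_clm_apply hA hK (Lp.memLp u)).coeFn_toLp

end Sobolev

/-! ### The matrix J: square -1, skew, isometric -/

section Symplectic

variable {N : ℕ} {J : Matrix (Fin (2 * N)) (Fin (2 * N)) ℝ}

theorem act_act (hJ : IsSymplecticUnit J) (x : Phase N) : act J (act J x) = -x := by
  have h : J * J = -1 := by
    have := hJ.1
    rw [hJ.2, neg_mul] at this
    rw [← this, neg_neg]
  rw [← mul_apply_eq_comp, ← map_mul, h, map_neg, map_one]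
  rfl

theorem inner_act (hJ : IsSymplecticUnit J) (x y : Phase N) :
    inner ℝ (act J x) y = -inner ℝ x (act J y) := by
  have h : ContinuousLinearMap.adjoint (act J) = -act J := by
    rw [← ContinuousLinearMap.star_eq_adjoint, ← map_star, Matrix.star_eq_conjTranspose,
      Matrix.conjTranspose_eq_transpose_of_trivial, hJ.2, map_neg]
  rw [← ContinuousLinearMap.adjoint_inner_right, h]
  simp

theorem norm_act (hJ : IsSymplecticUnit J) (x : Phase N) : ‖act J x‖ = ‖x‖ := by
  have h : ‖act J x‖ ^ 2 = ‖x‖ ^ 2 := by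
    rw [← real_inner_self_eq_norm_sq, inner_act hJ, act_act hJ, inner_neg_right, neg_neg,
      real_inner_self_eq_norm_sq]
  exact (sq_eq_sq₀ (norm_nonneg _) (norm_nonneg _)).1 h

end Symplectic

/-! ### An abstract criterion for index zero -/

section Fredholm

/-- An operator that is bounded below on a closed subspace of finite codimension, and whose kernel is
isomorphic to the orthogonal complement of its range, is Fredholm of index zero. -/
theorem isFredholmIndexZero_of_bound {X Y F : Type*} [NormedAddCommGroup X] [NormedSpace ℝ X]
    [CompleteSpace X] [NormedAddCommGroup Y] [InnerProductSpace ℝ Y] [CompleteSpace Y]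
    [NormedAddCommGroup F] [NormedSpace ℝ F] [FiniteDimensional ℝ F] {L : X →L[ℝ] Y}
    (ev : X →L[ℝ] F) {c : ℝ} (hc : ∀ x, ev x = 0 → ‖x‖ ≤ c * ‖L x‖) (e : L.ker ≃ₗ[ℝ] L.rangeᗮ) :
    IsFredholmIndexZero L := by
  set M : Submodule ℝ X := ev.ker with hM
  have hMc : IsClosed (M : Set X) := ev.isClosed_ker
  have hMf : M.CoFG := Submodule.CoFG.ker _
  have : CompleteSpace M := hMc.completeSpace_coe
  have hanti : AntilipschitzWith c.toNNReal (L.domRestrict M) := by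
    refine AddMonoidHomClass.antilipschitz_of_bound _ fun x => ?_
    refine (hc x x.2).trans ?_
    exact mul_le_mul_of_nonneg_right (Real.le_coe_toNNReal c) (norm_nonneg _)
  have hemb : IsClosedEmbedding (L.domRestrict M) :=
    hanti.isClosedEmbedding (L.domRestrict M).uniformContinuous
  -- Bounded below on M means a closed embedding there; closedness of the range passes from a
  -- subspace of finite codimension to the whole space.
  obtain ⟨hstrict, hclosed⟩ := (L.isStrictMap_isClosed_range_iff_restrict M hMc).2
    ⟨hemb.isEmbedding.isStrictMap, by
      rw [LinearMap.coe_range]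
      exact hemb.isClosed_range⟩
  have hdisj : Disjoint M L.ker := by
    rw [Submodule.disjoint_def]
    intro x hx hxL
    have hxL' : L x = 0 := hxL
    have := hc x hx
    rw [hxL', norm_zero, mul_zero] at this
    exact norm_le_zero_iff.1 this
  have hker : FiniteDimensional ℝ L.ker := by
    rw [← Submodule.fg_iff_finiteDimensional]
    exact hMf.fg_of_disjoint hdisj.symm
  have : CompleteSpace L.range := hclosed.completeSpace_coe
  -- The range being closed, its orthogonal complement is a model of the cokernel.
  let e' : (Y ⧸ L.range) ≃ₗ[ℝ] L.ker :=
    (L.range.quotientEquivOfIsCompl _ (Submodule.isCompl_orthogonal _)).trans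
      e.symm
  exact ⟨⟨hstrict, hclosed, hker, Module.Finite.equiv e'.symm,
    .of_disjoint_of_finiteDimensional_quotient hMc hdisj.symm⟩, e'.finrank_eq.symm⟩

end Fredholm

/-! ### The operator J x' - A x on H¹ -/

section LinearOperator

variable {N : ℕ} {J : Matrix (Fin (2 * N)) (Fin (2 * N)) ℝ}
  {A : ℝ → Phase N →L[ℝ] Phase N} {K : ℝ}

/-- The linear operator `x ↦ J x' - A(t) x` from `H¹` to `L²`. -/
noncomputable def linOp (J : Matrix (Fin (2 * N)) (Fin (2 * N)) ℝ) (A : ℝ → Phase N →L[ℝ] Phase N)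
    (hA : Continuous A) (K : ℝ) (hK : ∀ t, ‖A t‖ ≤ K) : H1 N →L[ℝ] L2 N :=
  (ContinuousLinearMap.compLpL 2 volume (act J)).comp sobDerivL - (mulL2 A hA K hK).comp sobFnL

/-- The coefficients of the system `J x' = A(t) x` solved for `x'`. -/
noncomputable def coeffB (J : Matrix (Fin (2 * N)) (Fin (2 * N)) ℝ)
    (A : ℝ → Phase N →L[ℝ] Phase N) (t : ℝ) : Phase N →L[ℝ] Phase N := -(act J).comp (A t)

theorem continuous_coeffB (hA : Continuous A) : Continuous (coeffB J A) :=
  (continuous_const.clm_comp hA).neg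

theorem act_coeffB (hJ : IsSymplecticUnit J) (t : ℝ) (x : Phase N) :
    act J (coeffB J A t x) = A t x := by
  simp only [coeffB, neg_apply, ContinuousLinearMap.comp_apply, map_neg, act_act hJ, neg_neg]

/-- J is an isometry, so passing from A to -J A loses nothing and convergence of coefficients
carries over. -/
theorem norm_coeffB_sub (hJ : IsSymplecticUnit J) (A' : ℝ → Phase N →L[ℝ] Phase N) (t : ℝ) :
    ‖coeffB J A t - coeffB J A' t‖ ≤ ‖A t - A' t‖ := by
  refine ContinuousLinearMap.opNorm_le_bound _ (norm_nonneg _) fun x => ?_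
  rw [← norm_act hJ, sub_apply, map_sub, act_coeffB hJ, act_coeffB hJ, ← sub_apply]
  exact (A t - A' t).le_opNorm x

theorem norm_coeffB_le (hJ : IsSymplecticUnit J) (hK : ∀ t, ‖A t‖ ≤ K) (t : ℝ) :
    ‖coeffB J A t‖ ≤ K := by
  refine ContinuousLinearMap.opNorm_le_bound _ ((norm_nonneg _).trans (hK 0)) fun x => ?_
  rw [← norm_act hJ, act_coeffB hJ]
  exact (A t).le_of_opNorm_le (hK t) x

theorem eq_coeffB_iff (hJ : IsSymplecticUnit J) (t : ℝ) (x y : Phase N) :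
    y = coeffB J A t x ↔ act J y - A t x = 0 := by
  rw [sub_eq_zero, ← act_coeffB hJ (A := A)]
  refine ⟨fun h => by rw [h], fun h => ?_⟩
  have := congrArg (act J) h
  rw [act_act hJ, act_act hJ] at this
  exact neg_injective this

theorem coeFn_linOp (hA : Continuous A) (hK : ∀ t, ‖A t‖ ≤ K) (x : H1 N) :
    linOp J A hA K hK x =ᵐ[volume] fun t => act J (sobDeriv x t) - A t (rep x t) := by
  have h : linOp J A hA K hK x = (act J).compLp (sobDeriv x) - mulL2 A hA K hK (sobFn x) := rfl
  rw [h]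
  filter_upwards [Lp.coeFn_sub ((act J).compLp (sobDeriv x)) (mulL2 A hA K hK (sobFn x)),
    (act J).coeFn_compLp (sobDeriv x), coeFn_mulL2 hA hK (sobFn x), rep_ae_eq x] with t h1 h2 h3 h4
  rw [h1, Pi.sub_apply, h2, h3, h4]

theorem linOp_eq_zero_iff (hJ : IsSymplecticUnit J) (hA : Continuous A) (hK : ∀ t, ‖A t‖ ≤ K)
    (x : H1 N) : linOp J A hA K hK x = 0 ↔
      sobDeriv x =ᵐ[volume] fun t => coeffB J A t (rep x t) := by
  constructor
  · intro h
    have h0 := coeFn_linOp (J := J) hA hK x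
    rw [h] at h0
    filter_upwards [h0, Lp.coeFn_zero (Phase N) 2 (volume : Measure ℝ)] with t h1 h2
    rw [eq_coeffB_iff hJ, ← h1, h2]
    rfl
  · intro h
    refine Lp.ext ?_
    filter_upwards [h, coeFn_linOp (J := J) hA hK x,
      Lp.coeFn_zero (Phase N) 2 (volume : Measure ℝ)] with t h1 h2 h3
    rw [h2, h3, (eq_coeffB_iff hJ t _ _).1 h1]
    rfl

/-- Elements of the kernel are classical solutions. -/
theorem rep_hasDerivAt (hJ : IsSymplecticUnit J) (hA : Continuous A) (hK : ∀ t, ‖A t‖ ≤ K)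
    {x : H1 N} (hx : linOp J A hA K hK x = 0) (t : ℝ) :
    HasDerivAt (rep x) (coeffB J A t (rep x t)) t :=
  ((rep_isPrimitive x).congr_ae ((linOp_eq_zero_iff hJ hA hK x).1 hx)).hasDerivAt
    ((continuous_coeffB hA).clm_apply (rep_continuous x)) t

/-- The L² bound upgrades to the H¹ norm because x' = (x' - Bx) + Bx. The kernel of the two
evaluations is the finite-codimensional subspace of the Fredholm criterion. -/
theorem exists_norm_le_linOp (hJ : IsSymplecticUnit J) (hA : Continuous A) (hK : ∀ t, ‖A t‖ ≤ K)
    {R₁ R₂ C : ℝ} (hC0 : 0 ≤ C)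
    (hC : ∀ u v : ℝ → Phase N, IsPrimitive u v → MemLp u 2 volume → MemLp v 2 volume →
      u R₁ = 0 → u R₂ = 0 → ∫ t, ‖u t‖ ^ 2 ≤ C * ∫ t, ‖v t - coeffB J A t (u t)‖ ^ 2) :
    ∃ c, ∀ x : H1 N, ((evalCLM R₁).prod (evalCLM R₂)) x = 0 → ‖x‖ ≤ c * ‖linOp J A hA K hK x‖ := by
  refine ⟨Real.sqrt (C + 2 + 2 * K ^ 2 * C), fun x hx => ?_⟩
  have hx1 : rep x R₁ = 0 := congrArg Prod.fst hx
  have hx2 : rep x R₂ = 0 := congrArg Prod.snd hx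
  have h := hC _ _ (rep_isPrimitive x) (rep_memLp x) (Lp.memLp _) hx1 hx2
  have e1 : ∫ t, ‖rep x t‖ ^ 2 = ‖sobFn x‖ ^ 2 := by
    rw [L2_norm_sq]
    exact integral_congr_ae ((rep_ae_eq x).mono fun s hs => by simp only [hs])
  have hae : (fun t => ‖sobDeriv x t - coeffB J A t (rep x t)‖ ^ 2)
      =ᵐ[volume] fun t => ‖linOp J A hA K hK x t‖ ^ 2 := by
    filter_upwards [coeFn_linOp (J := J) hA hK x] with t ht
    rw [ht, ← norm_act hJ, map_sub, act_coeffB hJ]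
  rw [e1, integral_congr_ae hae, ← L2_norm_sq] at h
  have hint1 := L2_integrable_sq (linOp J A hA K hK x)
  have hint2 := L2_integrable_sq (sobFn x)
  have h2 : ‖sobDeriv x‖ ^ 2 ≤ 2 * ‖linOp J A hA K hK x‖ ^ 2 + 2 * K ^ 2 * ‖sobFn x‖ ^ 2 := by
    rw [L2_norm_sq, L2_norm_sq (linOp J A hA K hK x), L2_norm_sq (sobFn x), ← integral_const_mul,
      ← integral_const_mul, ← integral_add (hint1.const_mul _) (hint2.const_mul _)]
    refine integral_mono_ae (L2_integrable_sq _) ((hint1.const_mul _).add (hint2.const_mul _)) ?_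
    filter_upwards [hae, rep_ae_eq x] with t ht hr
    have h3 := sq_norm_add_le (sobDeriv x t - coeffB J A t (rep x t)) (coeffB J A t (rep x t))
    rw [sub_add_cancel, ht, hr] at h3
    have h4 : ‖coeffB J A t (sobFn x t)‖ ^ 2 ≤ (K * ‖sobFn x t‖) ^ 2 := by
      gcongr
      exact (coeffB J A t).le_of_opNorm_le (norm_coeffB_le hJ hK t) _
    rw [mul_pow] at h4
    refine h3.trans ?_
    linarith
  refine le_of_sq_le_sq ?_ (by positivity)
  rw [mul_pow, Real.sq_sqrt (by positivity), H1_norm_sq]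
  nlinarith [mul_le_mul_of_nonneg_left h (by positivity : 0 ≤ 2 * K ^ 2)]

/-- For symmetric coefficients, the kernel is isomorphic to the orthogonal complement of the range. -/
theorem exists_ker_equiv (hJ : IsSymplecticUnit J) (hA : Continuous A) (hK : ∀ t, ‖A t‖ ≤ K)
    (hsymm : ∀ t x y, inner ℝ (A t x) y = inner ℝ x (A t y)) :
    Nonempty ((linOp J A hA K hK).ker ≃ₗ[ℝ] (linOp J A hA K hK).rangeᗮ) := by
  set L := linOp J A hA K hK with hL
  have hLae : ∀ x : H1 N, L x =ᵐ[volume] fun t => act J (sobDeriv x t) - A t (rep x t) :=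
    fun x => coeFn_linOp hA hK x
  -- For y in the kernel, ⟨Lx, y⟩ is the integral of the derivative of ⟨Jx, y⟩, which is zero on ℝ;
  -- skewness of J and symmetry of A enter here.
  have hmem : ∀ x : L.ker, sobFn (x : H1 N) ∈ L.rangeᗮ := by
    intro y
    rw [Submodule.mem_orthogonal]
    rintro _ ⟨x, rfl⟩
    have hy := (linOp_eq_zero_iff hJ hA hK (y : H1 N)).1 y.2
    change inner ℝ (L x) (sobFn (y : H1 N)) = 0
    rw [L2.inner_def]
    have hJx : IsPrimitive (fun t => act J (rep x t)) (fun t => act J (sobDeriv x t)) :=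
      (rep_isPrimitive x).clm_comp (act J)
    rw [← hJx.integral_inner_add_inner_eq_zero (rep_isPrimitive (y : H1 N))
      ((act J).comp_memLp' (rep_memLp x)) ((act J).comp_memLp' (Lp.memLp (sobDeriv x)))
      (rep_memLp (y : H1 N)) (Lp.memLp _)]
    refine integral_congr_ae ?_
    filter_upwards [hLae x, hy, rep_ae_eq (y : H1 N)] with t h1 h2 h3
    rw [h1, h2, ← h3, inner_sub_left, inner_act hJ (rep x t), act_coeffB hJ, hsymm]
    rfl
  let Ψ : L.ker →ₗ[ℝ] L.rangeᗮ :=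
    { toFun := fun x => ⟨sobFn (x : H1 N), hmem x⟩
      map_add' := fun x y => rfl
      map_smul' := fun c x => rfl }
  refine ⟨LinearEquiv.ofBijective Ψ ⟨?_, ?_⟩⟩
  · rw [← LinearMap.ker_eq_bot, LinearMap.ker_eq_bot']
    intro x hx
    have hx0 : sobFn (x : H1 N) = 0 := congrArg Subtype.val hx
    have hr : rep (x : H1 N) = fun _ => 0 := by
      refine (eq_rep_of_ae_eq continuous_const ?_).symm
      rw [hx0]
      exact (Lp.coeFn_zero _ _ _).symm
    have hd : sobDeriv (x : H1 N) = 0 := by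
      refine Lp.ext ?_
      filter_upwards [(linOp_eq_zero_iff hJ hA hK (x : H1 N)).1 x.2,
        Lp.coeFn_zero (Phase N) 2 (volume : Measure ℝ)] with t h1 h2
      rw [h1, h2, hr, map_zero]
      rfl
    have hn := H1_norm_sq (x : H1 N)
    rw [hx0, hd] at hn
    have : ‖(x : H1 N)‖ = 0 := by simpa using hn
    exact Subtype.ext (norm_eq_zero.1 this)
  · rintro ⟨y, hy⟩
    -- z = By is the candidate for y'. Orthogonality of y to L(φ · Je) is, since J² = -1, exactly
    -- the weak equation y' = z tested against φe; so y lies in H¹ and in the kernel.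
    set z : L2 N := mulL2 (coeffB J A) (continuous_coeffB hA) K (norm_coeffB_le hJ hK) y with hz
    have hzae := coeFn_mulL2 (continuous_coeffB (J := J) hA) (norm_coeffB_le hJ hK) y
    have hweak : IsWeakDeriv y z := by
      rw [isWeakDeriv_iff]
      intro φ hφ hc e
      have hd : Continuous (deriv φ) := hφ.continuous_deriv (by simp)
      have horth := (Submodule.mem_orthogonal _ _).1 hy
        (L (ofPrimitive (isPrimitive_test (hφ.of_le (by simp)) (act J e))
          (memLp_test hφ.continuous hc _) (memLp_test hd hc.deriv _))) ⟨_, rfl⟩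
      set x := ofPrimitive (isPrimitive_test (hφ.of_le (by simp)) (act J e))
          (memLp_test hφ.continuous hc _) (memLp_test hd hc.deriv _) with hx
      have hrep : rep x = fun t => φ t • act J e :=
        (eq_rep_of_ae_eq (hφ.continuous.smul continuous_const)
          (memLp_test hφ.continuous hc _).coeFn_toLp.symm).symm
      have hdx : sobDeriv x =ᵐ[volume] fun t => deriv φ t • act J e :=
        (memLp_test hd hc.deriv _).coeFn_toLp
      have hsum : inner ℝ (L x) y = -(inner ℝ ((memLp_test hd hc.deriv e).toLp : L2 N) y +
          inner ℝ ((memLp_test hφ.continuous hc e).toLp : L2 N) z) := by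
        rw [L2.inner_def, L2.inner_def, L2.inner_def,
          ← integral_add (L2.integrable_inner _ _) (L2.integrable_inner _ _), ← integral_neg]
        refine integral_congr_ae ?_
        filter_upwards [hLae x, hdx, (memLp_test hd hc.deriv e).coeFn_toLp,
          (memLp_test hφ.continuous hc e).coeFn_toLp, hzae] with t h1 h2 h3 h4 h5
        rw [h1, h2, h3, h4, hz, h5, hrep]
        simp only [map_smul, act_act hJ, inner_sub_left, inner_smul_left, inner_neg_left, hsymm,
          inner_act hJ, coeffB, neg_apply, ContinuousLinearMap.comp_apply, inner_neg_right]
        ring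
      rw [hsum] at horth
      linarith
    set x : H1 N := ⟨WithLp.toLp 2 (y, z), hweak⟩ with hx
    have hxk : L x = 0 := by
      rw [hL, linOp_eq_zero_iff hJ]
      filter_upwards [hzae, rep_ae_eq x] with t h1 h2
      rw [h2]
      exact h1
    exact ⟨⟨x, hxk⟩, rfl⟩

end LinearOperator

/-! ### The Hamiltonian nonlinearity and its linearisation at zero -/

section Hamiltonian

variable {N : ℕ} {H : ℝ → Phase N → ℝ → ℝ} {lam : ℝ}

/-- The gradient is the Riesz isomorphism applied to the differential, so this is the symmetry of
the second derivative of a C² function. -/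
theorem inner_hessH (h1 : HypH1 H) (t : ℝ) (ξ x y : Phase N) :
    inner ℝ (hessH H t ξ lam x) y = inner ℝ x (hessH H t ξ lam y) := by
  set f : Phase N → ℝ := fun η => H t η lam with hf
  have hsymm : IsSymmSndFDerivAt ℝ f ξ :=
    (h1.contDiff t lam).contDiffAt.isSymmSndFDerivAt (by simp)
  have key : ∀ v w, inner ℝ (hessH H t ξ lam v) w = fderiv ℝ (fderiv ℝ f) ξ v w := by
    intro v w
    set Φ : (Phase N →L[ℝ] ℝ) ≃L[ℝ] Phase N :=
      ((InnerProductSpace.toDual ℝ (Phase N)).symm.toContinuousLinearEquiv) with hΦ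
    have hg : (fun η => gradH H t η lam) = Φ ∘ fderiv ℝ f := rfl
    have : hessH H t ξ lam v = Φ (fderiv ℝ (fderiv ℝ f) ξ v) := by
      rw [hessH, hg, Φ.comp_fderiv]
      rfl
    rw [this]
    exact InnerProductSpace.toDual_symm_apply
  rw [key, real_inner_comm, key]
  exact hsymm x y

theorem continuous_hessH_zero (h2 : HypH2 H) : Continuous fun t => hessH H t 0 lam :=
  h2.cont_hess.comp (by fun_prop : Continuous fun t : ℝ => (t, (0 : Phase N), lam))

/-- A periodic equicontinuous `C¹`-bundle map has bounded derivative on bounded sets. -/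
theorem IsC1BundleMap.exists_norm_fderiv_le {g : ℝ → Phase N → Phase N} (hg : IsC1BundleMap g) {T : ℝ}
    (hT : 0 < T) (hp : ∀ t ξ, g (t + T) ξ - g t ξ = 0) (r : ℝ) :
    ∃ K : ℝ, ∀ t ξ, ‖ξ‖ ≤ r → ‖fderiv ℝ (g t) ξ‖ ≤ K := by
  obtain ⟨K, hK⟩ := (isCompact_Icc.prod (isCompact_closedBall (0 : Phase N) r)
    ).exists_bound_of_continuousOn (s := Set.Icc 0 T ×ˢ Metric.closedBall (0 : Phase N) r)
    hg.2.2.1.continuousOn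
  refine ⟨K, fun t ξ hξ => ?_⟩
  have hper : Function.Periodic g T := fun t => funext fun ξ => sub_eq_zero.1 (hp t ξ)
  obtain ⟨s, hs, e⟩ := hper.exists_mem_Ico₀ hT t
  rw [e]
  exact hK (s, ξ) ⟨⟨hs.1, hs.2.le⟩, by simpa using hξ⟩

variable {gp gm : ℝ → Phase N → ℝ → Phase N} {Tp Tm : ℝ → ℝ}

/-- Near ±∞ the Hessian is within distance 1 of a periodic, hence bounded, derivative; the remaining
times form a compact set. The bound is thus uniform in t for every λ. -/
theorem exists_norm_hessH_le (h2 : HypH2 H) (hinf : HypHInf H gp gm Tp Tm) (lam r : ℝ) :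
    ∃ K : ℝ, ∀ t ξ, ‖ξ‖ ≤ r → ‖hessH H t ξ lam‖ ≤ K := by
  obtain ⟨Kp, hKp⟩ := (hinf.bundle_p lam).exists_norm_fderiv_le (hinf.period_pos_p lam)
    (fun t ξ => hinf.periodic_p lam t ξ) r
  obtain ⟨Km, hKm⟩ := (hinf.bundle_m lam).exists_norm_fderiv_le (hinf.period_pos_m lam)
    (fun t ξ => hinf.periodic_m lam t ξ) r
  have hb := Metric.isBounded_closedBall (x := (0 : Phase N)) (r := r)
  obtain ⟨b, hb'⟩ := eventually_atTop.1
    (Metric.tendstoUniformlyOn_iff.1 (hinf.lim_p lam _ hb) 1 one_pos)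
  obtain ⟨a, ha'⟩ := eventually_atBot.1
    (Metric.tendstoUniformlyOn_iff.1 (hinf.lim_m lam _ hb) 1 one_pos)
  obtain ⟨K₀, hK₀⟩ := (isCompact_Icc.prod (isCompact_closedBall (0 : Phase N) r)
    ).exists_bound_of_continuousOn (s := Set.Icc a b ×ˢ Metric.closedBall (0 : Phase N) r)
    (f := fun p : ℝ × Phase N => hessH H p.1 p.2 lam)
    (h2.cont_hess.comp (by fun_prop :
      Continuous fun p : ℝ × Phase N => (p.1, p.2, lam))).continuousOn
  have hclose : ∀ {X Y : Phase N →L[ℝ] Phase N} {K : ℝ}, dist 0 (X - Y) < 1 → ‖Y‖ ≤ K →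
      ‖X‖ ≤ K + 1 := by
    intro X Y K h hY
    rw [dist_comm, dist_zero_right] at h
    have := norm_add_le (X - Y) Y
    rw [sub_add_cancel] at this
    linarith
  refine ⟨max K₀ (max (Kp + 1) (Km + 1)), fun t ξ hξ => ?_⟩
  have hξ' : ξ ∈ Metric.closedBall (0 : Phase N) r := by simpa using hξ
  by_cases h1 : b ≤ t
  · exact (hclose (hb' t h1 ξ hξ') (hKp t ξ hξ)).trans
      ((le_max_left _ _).trans (le_max_right _ _))
  by_cases h2 : t ≤ a
  · exact (hclose (ha' t h2 ξ hξ') (hKm t ξ hξ)).trans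
      ((le_max_right _ _).trans (le_max_right _ _))
  · exact (hK₀ (t, ξ) ⟨⟨(not_le.1 h2).le, (not_le.1 h1).le⟩, hξ'⟩).trans (le_max_left _ _)

/-- Mean value inequality from the zero of the gradient at ξ = 0. Linear growth on balls is what
makes the Nemytskii operator L²-valued, elements of H¹ being bounded. -/
theorem exists_norm_gradH_le (h1 : HypH1 H) (h2 : HypH2 H) (hinf : HypHInf H gp gm Tp Tm)
    (lam r : ℝ) : ∃ K : ℝ, ∀ t ξ, ‖ξ‖ ≤ r → ‖gradH H t ξ lam‖ ≤ K * ‖ξ‖ := by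
  obtain ⟨K, hK⟩ := exists_norm_hessH_le h2 hinf lam r
  refine ⟨K, fun t ξ hξ => ?_⟩
  have h := (convex_closedBall (0 : Phase N) r).norm_image_sub_le_of_norm_fderiv_le (𝕜 := ℝ)
    (f := fun η => gradH H t η lam) (fun η _ => h2.diff_hess t lam η)
    (fun η hη => hK t η (by simpa using hη))
    (by simpa using (norm_nonneg ξ).trans hξ : (0 : Phase N) ∈ _) (by simpa using hξ : ξ ∈ _)
  simpa [h1.grad_zero] using h

theorem memLp_gradH (h1 : HypH1 H) (h2 : HypH2 H) (hinf : HypHInf H gp gm Tp Tm) (x : H1 N) :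
    MemLp (fun t => gradH H t (sobFn x t) lam) 2 volume := by
  obtain ⟨K, hK⟩ := exists_norm_gradH_le h1 h2 hinf lam (Real.sqrt 2 * ‖x‖)
  have hae : (fun t => gradH H t (rep x t) lam) =ᵐ[volume] fun t => gradH H t (sobFn x t) lam :=
    (rep_ae_eq x).mono fun t ht => by simp only [ht]
  refine (memLp_congr_ae hae).1 (MemLp.of_le_mul (c := K) (rep_memLp x) ?_
    (Eventually.of_forall fun t => hK t _ (norm_rep_le x t)))
  have hc := rep_continuous x
  exact (h2.cont_grad.comp (by fun_prop :
    Continuous fun t : ℝ => (t, rep x t, lam))).aestronglyMeasurable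

theorem coeFn_nemytskii (h1 : HypH1 H) (h2 : HypH2 H) (hinf : HypHInf H gp gm Tp Tm) (x : H1 N) :
    nemytskii H lam x =ᵐ[volume] fun t => gradH H t (rep x t) lam := by
  rw [nemytskii, dif_pos (memLp_gradH h1 h2 hinf x)]
  filter_upwards [(memLp_gradH (lam := lam) h1 h2 hinf x).coeFn_toLp, rep_ae_eq x] with t h h'
  rw [h, h']

/-- The gradient is differentiable at the zero section, uniformly in time. -/
theorem exists_norm_gradH_sub_le (h1 : HypH1 H) (h2 : HypH2 H) (h3 : HypH3 H) (lam : ℝ) {ε : ℝ}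
    (hε : 0 < ε) : ∃ δ > 0, ∀ t ξ, ‖ξ‖ < δ →
      ‖gradH H t ξ lam - hessH H t 0 lam ξ‖ ≤ ε * ‖ξ‖ := by
  have heq := (h3.grad_bundle lam).2.2.2
  -- Equicontinuity of the Hessians at ξ = 0 provides a δ independent of t.
  obtain ⟨δ, hδ, hd⟩ := Metric.equicontinuousAt_iff.1 (heq 0) ε hε
  refine ⟨δ, hδ, fun t ξ hξ => ?_⟩
  have h := (convex_ball (0 : Phase N) δ).norm_image_sub_le_of_norm_fderiv_le' (𝕜 := ℝ)
    (f := fun η => gradH H t η lam) (φ := hessH H t 0 lam) (C := ε)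
    (fun η _ => h2.diff_hess t lam η) (fun η hη => by
      have := hd η hη t
      rw [dist_comm, dist_eq_norm] at this
      exact this.le)
    (Metric.mem_ball_self hδ : (0 : Phase N) ∈ _) (by simpa using hξ : ξ ∈ _)
  simpa [h1.grad_zero] using h

/-- The term J x' is linear, so only the Nemytskii remainder matters. When √2‖x‖ < δ the embedding
keeps x(t) in the δ-ball for all t, and the remainder is at most ε‖x(t)‖ almost everywhere. -/
theorem hasFDerivAt_F {J : Matrix (Fin (2 * N)) (Fin (2 * N)) ℝ} (h1 : HypH1 H) (h2 : HypH2 H)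
    (h3 : HypH3 H) (hinf : HypHInf H gp gm Tp Tm) {K : ℝ} (hK : ∀ t, ‖hessH H t 0 lam‖ ≤ K) :
    HasFDerivAt (F J H lam)
      (linOp J (fun t => hessH H t 0 lam) (continuous_hessH_zero h2) K hK) 0 := by
  have hn0 : nemytskii H lam (0 : H1 N) = 0 := by
    refine Lp.ext ?_
    have hr : rep (0 : H1 N) = fun _ => 0 :=
      (eq_rep_of_ae_eq continuous_const (Lp.coeFn_zero (Phase N) 2 (volume : Measure ℝ)).symm).symm
    filter_upwards [coeFn_nemytskii (lam := lam) h1 h2 hinf (0 : H1 N),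
      Lp.coeFn_zero (Phase N) 2 (volume : Measure ℝ)] with t h h'
    rw [h, h', hr, h1.grad_zero]
    rfl
  rw [hasFDerivAt_iff_isLittleO_nhds_zero, Asymptotics.isLittleO_iff]
  intro ε hε
  obtain ⟨δ, hδ, hd⟩ := exists_norm_gradH_sub_le h1 h2 h3 lam hε
  have hpos : 0 < δ / Real.sqrt 2 := by positivity
  filter_upwards [Metric.ball_mem_nhds (0 : H1 N) hpos] with x hx
  have hx' : Real.sqrt 2 * ‖x‖ < δ := by
    rw [mem_ball_zero_iff, lt_div_iff₀ (by positivity)] at hx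
    linarith
  set A := mulL2 (fun t => hessH H t 0 lam) (continuous_hessH_zero h2) K hK with hA
  have e : F J H lam (0 + x) - F J H lam 0 -
      linOp J (fun t => hessH H t 0 lam) (continuous_hessH_zero h2) K hK x
      = -(nemytskii H lam x - A (sobFn x)) := by
    have e1 : F J H lam 0 = 0 := by
      have : sobDeriv (0 : H1 N) = 0 := rfl
      rw [F, hn0, sub_zero, this]
      exact map_zero (ContinuousLinearMap.compLpL 2 volume (act J))
    have e2 : linOp J (fun t => hessH H t 0 lam) (continuous_hessH_zero h2) K hK x
        = (act J).compLp (sobDeriv x) - A (sobFn x) := rfl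
    rw [zero_add, e1, e2, F]
    abel
  rw [e, norm_neg]
  have hle : ‖nemytskii H lam x - A (sobFn x)‖ ≤ ε * ‖sobFn x‖ := by
    refine Lp.norm_le_mul_norm_of_ae_le_mul ?_
    filter_upwards [Lp.coeFn_sub (nemytskii H lam x) (A (sobFn x)),
      coeFn_nemytskii (lam := lam) h1 h2 hinf x,
      coeFn_mulL2 (continuous_hessH_zero (lam := lam) h2) hK (sobFn x), rep_ae_eq x] with t i1 i2 i3 i4
    rw [i1, Pi.sub_apply, i2, i3, ← i4]
    exact hd t _ ((norm_rep_le x t).trans_lt hx')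
  refine hle.trans ?_
  gcongr
  refine le_of_sq_le_sq ?_ (norm_nonneg _)
  rw [H1_norm_sq]
  linarith [sq_nonneg ‖sobDeriv x‖]

/-- The `L²` bound for the limiting periodic systems. -/
theorem exists_hasL2Bound_of_charMultiplier {J : Matrix (Fin (2 * N)) (Fin (2 * N)) ℝ}
    (hJ : IsSymplecticUnit J) {g : ℝ → Phase N → Phase N} (hg : IsC1BundleMap g) {T : ℝ}
    (hT : 0 < T) (hper : ∀ t ξ, g (t + T) ξ - g t ξ = 0)
    (hmult : ∀ ρ : ℂ, IsCharMultiplier J (fun t => fderiv ℝ (g t) 0) T ρ → ‖ρ‖ ≠ 1) :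
    ∃ C : ℝ, 0 ≤ C ∧ HasL2Bound (coeffB J fun t => fderiv ℝ (g t) 0) C := by
  have hA : Continuous fun t => fderiv ℝ (g t) 0 :=
    hg.2.2.1.comp (by fun_prop : Continuous fun t : ℝ => (t, (0 : Phase N)))
  have hp : Function.Periodic (coeffB J fun t => fderiv ℝ (g t) 0) T := by
    intro t
    have : g (t + T) = g t := funext fun ξ => sub_eq_zero.1 (hper t ξ)
    simp only [coeffB, this]
  refine exists_hasL2Bound_of_periodic (continuous_coeffB hA) hT hp fun X hX0 hX ρ hρ =>
    hmult ρ ⟨X, ⟨hX0, fun t => (hX t).differentiableAt, fun t => ?_⟩, hρ⟩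
  rw [(hX t).deriv]
  ext1 x
  simp only [sub_apply, ContinuousLinearMap.comp_apply, act_coeffB hJ, sub_self, zero_apply]

theorem tendsto_coeffB_sub {J : Matrix (Fin (2 * N)) (Fin (2 * N)) ℝ} (hJ : IsSymplecticUnit J)
    {g : ℝ → Phase N → ℝ → Phase N} {l : Filter ℝ}
    (h : TendstoUniformlyOn (fun t ξ => hessH H t ξ lam - fderiv ℝ (fun η => g t η lam) ξ)
      (fun _ => 0) l {0}) :
    Tendsto (fun t => coeffB J (fun t => hessH H t 0 lam) t -
      coeffB J (fun t => fderiv ℝ (fun η => g t η lam) 0) t) l (𝓝 0) := by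
  have h0 := (h.tendsto_at (Set.mem_singleton 0)).norm
  rw [norm_zero] at h0
  exact squeeze_zero_norm (fun t => norm_coeffB_sub hJ _ t) h0

theorem memLp_of_exp_decay {E : Type*} [NormedAddCommGroup E] {u : ℝ → E} (hu : Continuous u)
    {D γ : ℝ} (hγ : 0 < γ) (h : ∀ t, ‖u t‖ ≤ D * Real.exp (-γ * |t|)) : MemLp u 2 volume := by
  rw [memLp_two_iff_integrable_sq_norm hu.aestronglyMeasurable]
  -- Chosen so that m(1 + t²) ≤ 1 + γ|t| + (γ|t|)²/2 ≤ exp(γ|t|), which compares the decay with the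
  -- integrable function 1/(1 + t²).
  set m : ℝ := min 1 (γ ^ 2 / 2) with hm
  have hm0 : 0 < m := lt_min one_pos (by positivity)
  have hD : 0 ≤ D := by simpa using (norm_nonneg _).trans (h 0)
  refine Integrable.mono' ((integrable_inv_one_add_sq.const_mul (D ^ 2 * m⁻¹)))
    (by fun_prop) (Eventually.of_forall fun t => ?_)
  rw [Real.norm_of_nonneg (by positivity)]
  have h1 : Real.exp (-γ * |t|) ^ 2 ≤ m⁻¹ * (1 + t ^ 2)⁻¹ := by
    have hx : 0 ≤ γ * |t| := by positivity
    have hle1 : Real.exp (-γ * |t|) ≤ 1 := Real.exp_le_one_iff.2 (by linarith)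
    have hq := Real.quadratic_le_exp_of_nonneg hx
    have h2 : m * (1 + t ^ 2) ≤ Real.exp (γ * |t|) := by
      have a1 : m ≤ 1 := min_le_left _ _
      have a2 : m ≤ γ ^ 2 / 2 := min_le_right _ _
      have a3 : (γ * |t|) ^ 2 = γ ^ 2 * t ^ 2 := by rw [mul_pow, sq_abs]
      nlinarith [mul_le_mul_of_nonneg_right a2 (sq_nonneg t)]
    calc Real.exp (-γ * |t|) ^ 2 ≤ Real.exp (-γ * |t|) := by
          rw [sq]; exact mul_le_of_le_one_left (Real.exp_pos _).le hle1
      _ = (Real.exp (γ * |t|))⁻¹ := by rw [neg_mul, Real.exp_neg]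
      _ ≤ (m * (1 + t ^ 2))⁻¹ := by gcongr
      _ = _ := by rw [mul_inv]
  calc ‖u t‖ ^ 2 ≤ (D * Real.exp (-γ * |t|)) ^ 2 := by gcongr; exact h t
    _ = D ^ 2 * Real.exp (-γ * |t|) ^ 2 := by ring
    _ ≤ D ^ 2 * (m⁻¹ * (1 + t ^ 2)⁻¹) := by gcongr
    _ = _ := by ring

theorem hasDerivAt_of_mem_solN {J : Matrix (Fin (2 * N)) (Fin (2 * N)) ℝ} (hJ : IsSymplecticUnit J)
    {u : ℝ → Phase N} (hu : u ∈ solN J H lam) (t : ℝ) :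
    HasDerivAt u (coeffB J (fun t => hessH H t 0 lam) t (u t)) t := by
  rw [← (eq_coeffB_iff hJ (A := fun t => hessH H t 0 lam) t (u t) (deriv u t)).2 (hu.2.1 t)]
  exact (hu.1.differentiable one_ne_zero t).hasDerivAt

theorem rep_mem_solN {J : Matrix (Fin (2 * N)) (Fin (2 * N)) ℝ} (hJ : IsSymplecticUnit J)
    (h2 : HypH2 H) {K : ℝ} (hK : ∀ t, ‖hessH H t 0 lam‖ ≤ K) {x : H1 N}
    (hx : linOp J (fun t => hessH H t 0 lam) (continuous_hessH_zero h2) K hK x = 0) :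
    rep x ∈ solN J H lam := by
  have hd := rep_hasDerivAt hJ (continuous_hessH_zero h2) hK hx
  have hd' : deriv (rep x) = fun t => coeffB J (fun t => hessH H t 0 lam) t (rep x t) :=
    funext fun t => (hd t).deriv
  refine ⟨contDiff_one_iff_deriv.2 ⟨fun t => (hd t).differentiableAt, ?_⟩, fun t => ?_,
    (rep_isPrimitive x).tendsto_atBot (rep_memLp x) (Lp.memLp _),
    (rep_isPrimitive x).tendsto_atTop (rep_memLp x) (Lp.memLp _)⟩
  · rw [hd']
    exact (continuous_coeffB (continuous_hessH_zero h2)).clm_apply (rep_continuous x)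
  · rw [← eq_coeffB_iff hJ (A := fun t => hessH H t 0 lam), hd']

end Hamiltonian

end HamHom

/-! ### Assembly of the main theorem -/

theorem theorem5p1 {N : ℕ} (J : Matrix (Fin (2 * N)) (Fin (2 * N)) ℝ)
    (hJ : HamHom.IsSymplecticUnit J)
    (H : ℝ → HamHom.Phase N → ℝ → ℝ)
    (h1 : HamHom.HypH1 H) (h2 : HamHom.HypH2 H) (h3 : HamHom.HypH3 H) (h4 : HamHom.HypH4 H)
    (gp gm : ℝ → HamHom.Phase N → ℝ → HamHom.Phase N) (Tp Tm : ℝ → ℝ)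
    (hinf : HamHom.HypHInf H gp gm Tp Tm)
    (lam : ℝ)
    (hp : ∀ ρ : ℂ, HamHom.IsCharMultiplier J
      (fun t => fderiv ℝ (fun ξ => gp t ξ lam) 0) (Tp lam) ρ → ‖ρ‖ ≠ 1)
    (hm : ∀ ρ : ℂ, HamHom.IsCharMultiplier J
      (fun t => fderiv ℝ (fun ξ => gm t ξ lam) 0) (Tm lam) ρ → ‖ρ‖ ≠ 1) :
    -- `F(λ, ·)` is well defined from `H¹` to `L²` and differentiable at `0`
    (∀ x : HamHom.H1 N, MemLp (fun t => HamHom.gradH H t (HamHom.sobFn x t) lam) 2 (volume : Measure ℝ)) ∧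
    DifferentiableAt ℝ (HamHom.F J H lam) 0 ∧
    -- Fredholm of index zero
    HamHom.IsFredholmIndexZero (HamHom.DxF J H lam 0) ∧
    -- the kernel is `N(λ)`, up to equality almost everywhere
    {f : ℝ → HamHom.Phase N | ∃ x ∈ (HamHom.DxF J H lam 0).ker, f =ᵐ[volume] HamHom.sobFn x} =
      {f : ℝ → HamHom.Phase N | ∃ u ∈ HamHom.solN J H lam, f =ᵐ[volume] u} ∧
    -- exponential decay
    (∀ u ∈ HamHom.solN J H lam, ∃ C γ : ℝ, 0 < γ ∧ ∀ t : ℝ, ‖u t‖ ≤ C * Real.exp (-γ * |t|)) := by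
  open HamHom in
  -- Radius 0: only the coefficients along the zero solution enter the linearised operator.
  obtain ⟨K, hK⟩ := exists_norm_hessH_le h2 hinf lam 0
  replace hK : ∀ t, ‖hessH H t 0 lam‖ ≤ K := fun t => hK t 0 (by simp)
  have hA := continuous_hessH_zero (lam := lam) h2
  have hF := hasFDerivAt_F (J := J) h1 h2 h3 hinf hK
  have hDF : DxF J H lam 0 = linOp J (fun t => hessH H t 0 lam) hA K hK := hF.fderiv
  have hBc := continuous_coeffB (J := J) hA
  have hBK := norm_coeffB_le hJ hK
  obtain ⟨Cp, hCp, hBp⟩ := exists_hasL2Bound_of_charMultiplier hJ (hinf.bundle_p lam)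
    (hinf.period_pos_p lam) (fun t ξ => hinf.periodic_p lam t ξ) hp
  obtain ⟨Cm, hCm, hBm⟩ := exists_hasL2Bound_of_charMultiplier hJ (hinf.bundle_m lam)
    (hinf.period_pos_m lam) (fun t ξ => hinf.periodic_m lam t ξ) hm
  have hlp := tendsto_coeffB_sub hJ (hinf.lim_p lam {0} Bornology.isBounded_singleton)
  have hlm := tendsto_coeffB_sub hJ (hinf.lim_m lam {0} Bornology.isBounded_singleton)
  have hdecay : ∀ u ∈ solN J H lam, ∃ C γ : ℝ, 0 < γ ∧ ∀ t : ℝ, ‖u t‖ ≤ C * Real.exp (-γ * |t|) :=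
    fun u hu => exists_exp_decay hBc hBK hCp hCm hBp hBm hlp hlm (hasDerivAt_of_mem_solN hJ hu)
      hu.2.2.2 hu.2.2.1
  refine ⟨memLp_gradH h1 h2 hinf, hF.differentiableAt, ?_, ?_, hdecay⟩
  · rw [hDF]
    obtain ⟨R₁, R₂, C, hC0, hC⟩ := exists_bound_of_vanishing hBc hBK hCp hCm hBp hBm hlp hlm
    obtain ⟨c, hc⟩ := exists_norm_le_linOp hJ hA hK hC0 hC
    obtain ⟨e⟩ := exists_ker_equiv hJ hA hK (fun t x y => inner_hessH h1 t 0 x y)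
    exact isFredholmIndexZero_of_bound _ hc e
  · rw [hDF]
    ext f
    constructor
    · rintro ⟨x, hx, hfx⟩
      exact ⟨rep x, rep_mem_solN hJ h2 hK hx, hfx.trans (rep_ae_eq x).symm⟩
    · rintro ⟨u, hu, hfu⟩
      -- A solution that merely tends to zero belongs to H¹ because it decays exponentially, so
      -- decay has to be known before the kernel can be identified.
      obtain ⟨D, γ, hγ, hD⟩ := hdecay u hu
      have hd := hasDerivAt_of_mem_solN hJ hu
      have huc : Continuous u := hu.1.continuous
      have huL := memLp_of_exp_decay huc hγ hD
      have hvL := memLp_clm_apply hBc hBK huL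
      have hprim := IsPrimitive.of_hasDerivAt hd (hBc.clm_apply huc)
      refine ⟨ofPrimitive hprim huL hvL, ?_, hfu.trans huL.coeFn_toLp.symm⟩
      refine (linOp_eq_zero_iff hJ hA hK _).2 ?_
      rw [← eq_rep_of_ae_eq (x := ofPrimitive hprim huL hvL) huc huL.coeFn_toLp.symm]
      exact hvL.coeFn_toLp
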